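/- Work in the universe $V$ of $\mathrm{ZFC}$; write $\mathbb{R}=\mathcal{P}(\omega)$. \textbf{Theories.} $ZFC_{count}$ is the theory in the language $\{\in\}$ that consists of $ZFC$ without the power set axiom, with the Collection scheme (and Separation), together with the axiom that every set is countable. $SOA$ is second order arithmetic with full comprehension and full choice: it is formulated as a theory with identity whose objects are numbers and sets of numbers (in one sort of variables, with a predicate for being a number; the objects that are not numbers are the sets). It consists of the basic axioms for $0,1,+,\cdot,<$ on the numbers, extensionality for sets, the induction axiom, the comprehension axiom $\exists X\,\forall n\,(n\in X\leftrightarrow\varphi(n))$ for every formula $\varphi$ (with parameters) in which $X$ is not free, and the choice axiom $\forall n\,\exists Y\,\varphi(n,Y)\rightarrow\exists Z\,\forall n\,\varphi(n,(Z)_n)$ for every formula $\varphi$ (with parameters) in which $Z$ is not free, where $(Z)_n=\{i : (i,n)\in Z\}$. \textbf{Definitional equivalence.} A translation of a language $\mathcal{L}'$ into a language $\mathcal{L}$ consists of a dimension $d\geq 1$ and parameter-free $\mathcal{L}$-formulas that define, in an $\mathcal{L}$-structure $\mathcal{A}$, a set of $d$-tuples as domain, an interpretation of identity on it, and an interpretation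 of each symbol of $\mathcal{L}'$; it thus produces an $\mathcal{L}'$-structure $t(\mathcal{A})$, whose identity may be interpreted by an equivalence relation other than true identity (a $1$-tuple is identified with its entry). Theories $T$ and $S$ are definitionally equivalent if there are translations $t$ and $s$ such that $t(\mathcal{A})\models S$ and $s(t(\mathcal{A}))=\mathcal{A}$ for all models $\mathcal{A}$ of $T$, and $s(\mathcal{B})\models T$ and $t(s(\mathcal{B}))=\mathcal{B}$ for all models $\mathcal{B}$ of $S$ (equality of structures, not just isomorphism). \textbf{Lemma.} Suppose that every ordinal definable well-ordering $R$ of a set $A\subseteq\mathbb{R}$ of reals has order type less than $\omega_1$ (where $R$ is ordinal definable if, for some formula $\varphi$ of set theory and some ordinals $\vec\alpha$, $R$ is the unique set with $\varphi(R,\vec\alpha)$). Then $SOA$ is not definitionally equivalent to $ZFC_{count}$. -/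

import Mathlib

open FirstOrder FirstOrder.Language
open scoped Ordinal

universe u

namespace SOAZFC

/-! ### Structures inside the universe of sets, and translations

The universe of sets is `V = ZFSet.{u}`. Languages are relational. -/

/-- Finite tuples of sets: the `1`-tuple of `x` is `x` itself, longer tuples are iterated pairs. -/
def tuple : ∀ {n : ℕ}, (Fin n → ZFSet.{u}) → ZFSet.{u}
  | 0, _ => ∅
  | 1, x => x 0
  | _ + 2, x => ZFSet.pair (x 0) (tuple fun i => x i.succ)

/-- An `L`-structure whose domain is a set, and which interprets the identity symbol by
a relation `eq` of its own (the identity on the domain when the structure is `Normal`). -/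
@[ext]
structure SetStructure (L : FirstOrder.Language.{0, 0}) where
  dom : ZFSet.{u}
  eq : ZFSet.{u} → ZFSet.{u} → Prop
  rel : ∀ {k : ℕ}, L.Relations k → (Fin k → ZFSet.{u}) → Prop
  dom_of_eq : ∀ x y, eq x y → x ∈ dom ∧ y ∈ dom
  dom_of_rel : ∀ {k : ℕ} (R : L.Relations k) (x : Fin k → ZFSet.{u}), rel R x → ∀ i, x i ∈ dom

/-- In a relational language every term is a variable. -/
def termVar {L : FirstOrder.Language.{0, 0}} [L.IsRelational] {β : Type} :
    L.Term β → β
  | .var b => b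
  | .func f _ => isEmptyElim f

namespace SetStructure

variable {L : FirstOrder.Language.{0, 0}} [L.IsRelational]

/-- Tarskian satisfaction: quantifiers range over the domain, and the identity symbol is read
as `A.eq`. -/
def Sat (A : SetStructure.{u} L) {α : Type} :
    ∀ {n : ℕ}, L.BoundedFormula α n → (α → ZFSet.{u}) → (Fin n → ZFSet.{u}) → Prop
  | _, .falsum, _, _ => False
  | _, .equal t₁ t₂, v, xs => A.eq (Sum.elim v xs (termVar t₁)) (Sum.elim v xs (termVar t₂))
  | _, .rel R ts, v, xs => A.rel R fun i => Sum.elim v xs (termVar (ts i))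
  | _, .imp φ ψ, v, xs => A.Sat φ v xs → A.Sat ψ v xs
  | _, .all φ, v, xs => ∀ x ∈ A.dom, A.Sat φ v (Fin.snoc xs x)

/-- Satisfaction of a formula by an assignment of its free variables. -/
def SatFormula (A : SetStructure.{u} L) {α : Type} (φ : L.Formula α) (v : α → ZFSet.{u}) : Prop :=
  A.Sat φ v Fin.elim0

/-- The identity symbol is interpreted by true identity. -/
def Normal (A : SetStructure.{u} L) : Prop :=
  ∀ x ∈ A.dom, ∀ y ∈ A.dom, A.eq x y ↔ x = y

/-- `A` is a model of `T`: the domain is not empty, the interpretation of identity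
satisfies the laws of identity, and all sentences of `T` hold. -/
structure IsModel (A : SetStructure.{u} L) (T : L.Theory) : Prop where
  nonempty : ∃ x, x ∈ A.dom
  refl : ∀ x ∈ A.dom, A.eq x x
  symm : ∀ x y, A.eq x y → A.eq y x
  trans : ∀ x y z, A.eq x y → A.eq y z → A.eq x z
  congr : ∀ {k : ℕ} (R : L.Relations k) (x y : Fin k → ZFSet.{u}),
    (∀ i, A.eq (x i) (y i)) → A.rel R x → A.rel R y
  sat : ∀ φ ∈ T, A.SatFormula φ Empty.elim

end SetStructure

/-- A parameter-free translation of the language `L'` into the language `L`. It may be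
many-dimensional (`dim`), relativized (`domF` defines the domain) and may use a quotient (`eqF`
interprets identity). The variable `(i, j)` stands for the `j`-th coordinate of the `i`-th
argument. -/
structure Translation (L' L : FirstOrder.Language.{0, 0}) where
  dim : ℕ
  dim_pos : 0 < dim
  domF : L.Formula (Fin dim)
  eqF : L.Formula (Fin 2 × Fin dim)
  relF : ∀ {k : ℕ}, L'.Relations k → L.Formula (Fin k × Fin dim)

namespace Translation

variable {L' L : FirstOrder.Language.{0, 0}} [L.IsRelational]

/-- The tuples of elements of `A` that satisfy the domain formula. -/
def InDom (t : Translation L' L) (A : SetStructure.{u} L) (x : Fin t.dim → ZFSet.{u}) : Prop :=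
  (∀ j, x j ∈ A.dom) ∧ A.SatFormula t.domF x

/-- The `L'`-structure that the translation `t` defines in the `L`-structure `A`. -/
noncomputable def app (t : Translation L' L) (A : SetStructure.{u} L) : SetStructure.{u} L' where
  dom := ZFSet.range fun x : {x : Fin t.dim → A.dom // t.InDom A fun j => (x j).1} =>
    tuple fun j => (x.1 j).1
  eq a b := ∃ x : Fin 2 → Fin t.dim → ZFSet.{u}, (∀ i, t.InDom A (x i)) ∧
    tuple (x 0) = a ∧ tuple (x 1) = b ∧ A.SatFormula t.eqF fun p => x p.1 p.2
  rel {k} R a := ∃ x : Fin k → Fin t.dim → ZFSet.{u}, (∀ i, t.InDom A (x i)) ∧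
    (∀ i, tuple (x i) = a i) ∧ A.SatFormula (t.relF R) fun p => x p.1 p.2
  dom_of_eq := by
    rintro a b ⟨x, hx, rfl, rfl, -⟩
    exact ⟨ZFSet.mem_range.2 ⟨⟨fun j => ⟨x 0 j, (hx 0).1 j⟩, hx 0⟩, rfl⟩,
      ZFSet.mem_range.2 ⟨⟨fun j => ⟨x 1 j, (hx 1).1 j⟩, hx 1⟩, rfl⟩⟩
  dom_of_rel := by
    rintro k R a ⟨x, hx, ha, -⟩ i
    exact ZFSet.mem_range.2 ⟨⟨fun j => ⟨x i j, (hx i).1 j⟩, hx i⟩, ha i⟩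

end Translation

/-- Definitional equivalence of `T` and `S`: there are translations `t` and `s` that turn models of
`T` into models of `S` and conversely, such that `s ∘ t` and `t ∘ s` return every model of `T`,
respectively `S`, itself (not only an isomorphic copy). -/
def DefinitionallyEquivalent {L L' : FirstOrder.Language.{0, 0}} [L.IsRelational] [L'.IsRelational]
    (T : L.Theory) (S : L'.Theory) : Prop :=
  ∃ (t : Translation L' L) (s : Translation L L'),
    (∀ A : SetStructure.{u} L, A.Normal → A.IsModel T → (t.app A).IsModel S) ∧
    (∀ B : SetStructure.{u} L', B.Normal → B.IsModel S → (s.app B).IsModel T) ∧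
    (∀ A : SetStructure.{u} L, A.Normal → A.IsModel T → s.app (t.app A) = A) ∧
    (∀ B : SetStructure.{u} L', B.Normal → B.IsModel S → t.app (s.app B) = B)

/-! ### Writing axioms

In a formula with bound variables, `&0` is the variable of the outermost quantifier, `&1` the next
one, and so on. The free variables `Fin n` of an axiom scheme are its parameters. -/

/-- Put bound variables for the distinguished variables `Fin k` of `φ`. -/
def inst {L : FirstOrder.Language.{0, 0}} {α : Type} {k m : ℕ} (φ : L.Formula (α ⊕ Fin k))
    (σ : Fin k → Fin m) : L.BoundedFormula α m :=
  BoundedFormula.relabel (Sum.map id σ) φ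

/-- The universal closure. -/
def univClosure {L : FirstOrder.Language.{0, 0}} {n : ℕ} (ψ : L.Formula (Fin n)) : L.Sentence :=
  BoundedFormula.alls (BoundedFormula.relabel (Sum.inr : Fin n → Empty ⊕ Fin n) ψ :
    L.BoundedFormula Empty n)

/-! ### Set theory in which every set is countable -/

inductive SetSymbol : ℕ → Type
  | mem : SetSymbol 2

/-- The language of set theory. -/
def Lset : FirstOrder.Language.{0, 0} := ⟨fun _ => Empty, SetSymbol⟩

instance : Lset.IsRelational := fun _ => inferInstanceAs (IsEmpty Empty)

namespace SetAxiom

variable {α : Type} {n : ℕ}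

def memSymbol : Lset.Relations 2 := SetSymbol.mem

/-- `x ∈ y` -/
def mem (x y : Fin n) : Lset.BoundedFormula α n :=
  Relations.boundedFormula₂ memSymbol (&x) (&y)

/-- `x = y` -/
def eq (x y : Fin n) : Lset.BoundedFormula α n := (&x) =' (&y)

/-- `z = {x, y}` -/
def isUPair (z x y : Fin n) : Lset.BoundedFormula α n :=
  ∀' (mem (Fin.last n) z.castSucc ⇔
    (eq (Fin.last n) x.castSucc ⊔ eq (Fin.last n) y.castSucc))

/-- `z = (x, y)`, the ordered pair `{{x}, {x, y}}` -/
def isPair (z x y : Fin n) : Lset.BoundedFormula α n :=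
  ∃' ∃' (isUPair (Fin.last n).castSucc x.castSucc.castSucc x.castSucc.castSucc ⊓
    isUPair (Fin.last (n + 1)) x.castSucc.castSucc y.castSucc.castSucc ⊓
    isUPair z.castSucc.castSucc (Fin.last n).castSucc (Fin.last (n + 1)))

/-- `(x, y) ∈ f` -/
def pairMem (x y f : Fin n) : Lset.BoundedFormula α n :=
  ∃' (isPair (Fin.last n) x.castSucc y.castSucc ⊓ mem (Fin.last n) f.castSucc)

/-- `x = ∅` -/
def isEmpty (x : Fin n) : Lset.BoundedFormula α n :=
  ∀' ∼(mem (Fin.last n) x.castSucc)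

/-- `y = x ∪ {x}` -/
def isSucc (y x : Fin n) : Lset.BoundedFormula α n :=
  ∀' (mem (Fin.last n) y.castSucc ⇔
    (mem (Fin.last n) x.castSucc ⊔ eq (Fin.last n) x.castSucc))

/-- `∅ ∈ w`, and `x ∪ {x} ∈ w` for all `x ∈ w` -/
def isInductive (w : Fin n) : Lset.BoundedFormula α n :=
  (∃' (isEmpty (Fin.last n) ⊓ mem (Fin.last n) w.castSucc)) ⊓
  (∀' (mem (Fin.last n) w.castSucc ⟹
    ∃' (isSucc (Fin.last (n + 1)) (Fin.last n).castSucc ⊓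
      mem (Fin.last (n + 1)) w.castSucc.castSucc)))

/-- `w = ω`, the least inductive set -/
def isOmega (w : Fin n) : Lset.BoundedFormula α n :=
  isInductive w ⊓ ∀' (isInductive (Fin.last n) ⟹
    ∀' (mem (Fin.last (n + 1)) w.castSucc.castSucc ⟹
      mem (Fin.last (n + 1)) (Fin.last n).castSucc))

def extensionality : Lset.Sentence :=
  ∀' ∀' ((∀' (mem 2 0 ⇔ mem 2 1)) ⟹ eq 0 1)

def foundation : Lset.Sentence :=
  ∀' ((∃' (mem 1 0)) ⟹ ∃' (mem 1 0 ⊓ ∀' (mem 2 1 ⟹ ∼(mem 2 0))))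

def pairing : Lset.Sentence :=
  ∀' ∀' ∃' (isUPair 2 0 1)

def union : Lset.Sentence :=
  ∀' ∃' ∀' (mem 2 1 ⇔ ∃' (mem 3 0 ⊓ mem 2 3))

def infinity : Lset.Sentence :=
  ∃' (isInductive 0)

/-- Every set of pairwise disjoint non-empty sets has a choice set. -/
def choice : Lset.Sentence :=
  ∀' (((∀' (mem 1 0 ⟹ ∃' (mem 2 1))) ⊓
      (∀' ∀' ((mem 1 0 ⊓ mem 2 0 ⊓ ∃' (mem 3 1 ⊓ mem 3 2)) ⟹ eq 1 2))) ⟹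
    ∃' ∀' (mem 2 0 ⟹ ∃' ∀' ((mem 4 2 ⊓ mem 4 1) ⇔ eq 4 3)))

/-- For every `a` there is `b` with `x ∈ b ↔ x ∈ a ∧ φ(x)` for all `x`. -/
def separation (φ : Lset.Formula (Fin n ⊕ Fin 1)) : Lset.Sentence :=
  univClosure (∀' ∃' ∀' (mem 2 1 ⇔ (mem 2 0 ⊓ inst φ ![2])))

/-- For every `a`, if for all `x ∈ a` there is `y` with `φ(x, y)`, then there is `b` such that for
all `x ∈ a` there is `y ∈ b` with `φ(x, y)`. -/
def collection (φ : Lset.Formula (Fin n ⊕ Fin 2)) : Lset.Sentence :=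
  univClosure (∀' ((∀' (mem 1 0 ⟹ ∃' (inst φ ![1, 2]))) ⟹
    ∃' ∀' (mem 2 0 ⟹ ∃' (mem 3 1 ⊓ inst φ ![2, 3]))))

/-- Every set `x` is countable: with `w = ω`, there is `f` that relates every `a ∈ x`
to exactly one set, which lies in `w`, and does not relate distinct elements of `x` to the same
set. -/
def countability : Lset.Sentence :=
  ∀' ∃' ∃' (isOmega 1 ⊓
    (∀' (mem 3 0 ⟹ ∃' (mem 4 1 ⊓ ∀' (pairMem 3 5 2 ⇔ eq 5 4)))) ⊓
    (∀' ∀' ∀' ((mem 3 0 ⊓ mem 4 0 ⊓ pairMem 3 5 2 ⊓ pairMem 4 5 2) ⟹ eq 3 4)))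

end SetAxiom

/-- `ZFC` without the power set axiom, with collection, and with the axiom that every set is
countable. -/
inductive ZFCcount : Lset.Theory
  | extensionality : ZFCcount SetAxiom.extensionality
  | foundation : ZFCcount SetAxiom.foundation
  | pairing : ZFCcount SetAxiom.pairing
  | union : ZFCcount SetAxiom.union
  | infinity : ZFCcount SetAxiom.infinity
  | choice : ZFCcount SetAxiom.choice
  | separation {n : ℕ} (φ : Lset.Formula (Fin n ⊕ Fin 1)) : ZFCcount (SetAxiom.separation φ)
  | collection {n : ℕ} (φ : Lset.Formula (Fin n ⊕ Fin 2)) : ZFCcount (SetAxiom.collection φ)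
  | countability : ZFCcount SetAxiom.countability

/-! ### Second order arithmetic -/

inductive ArithSymbol : ℕ → Type
  | num : ArithSymbol 1
  | zero : ArithSymbol 1
  | one : ArithSymbol 1
  | add : ArithSymbol 3
  | mul : ArithSymbol 3
  | lt : ArithSymbol 2
  | mem : ArithSymbol 2

/-- The language of second order arithmetic, with one sort of variables: `num` is the predicate
"is a number", the objects that are not numbers are the sets of numbers, and `0`, `1`, `+`, `·` are
given by their graphs. -/
def Larith : FirstOrder.Language.{0, 0} := ⟨fun _ => Empty, ArithSymbol⟩

instance : Larith.IsRelational := fun _ => inferInstanceAs (IsEmpty Empty)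

namespace ArithAxiom

variable {α : Type} {n : ℕ}

def numSymbol : Larith.Relations 1 := ArithSymbol.num

def zeroSymbol : Larith.Relations 1 := ArithSymbol.zero

def oneSymbol : Larith.Relations 1 := ArithSymbol.one

def addSymbol : Larith.Relations 3 := ArithSymbol.add

def mulSymbol : Larith.Relations 3 := ArithSymbol.mul

def ltSymbol : Larith.Relations 2 := ArithSymbol.lt

def memSymbol : Larith.Relations 2 := ArithSymbol.mem

/-- `x` is a number -/
def num (x : Fin n) : Larith.BoundedFormula α n :=
  Relations.boundedFormula₁ numSymbol (&x)

/-- `x = 0` -/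
def zero (x : Fin n) : Larith.BoundedFormula α n :=
  Relations.boundedFormula₁ zeroSymbol (&x)

/-- `x = 1` -/
def one (x : Fin n) : Larith.BoundedFormula α n :=
  Relations.boundedFormula₁ oneSymbol (&x)

/-- `x + y = z` -/
def add (x y z : Fin n) : Larith.BoundedFormula α n :=
  Relations.boundedFormula addSymbol ![&x, &y, &z]

/-- `x · y = z` -/
def mul (x y z : Fin n) : Larith.BoundedFormula α n :=
  Relations.boundedFormula mulSymbol ![&x, &y, &z]

/-- `x < y` -/
def lt (x y : Fin n) : Larith.BoundedFormula α n :=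
  Relations.boundedFormula₂ ltSymbol (&x) (&y)

/-- `x ∈ y` -/
def mem (x y : Fin n) : Larith.BoundedFormula α n :=
  Relations.boundedFormula₂ memSymbol (&x) (&y)

/-- `x = y` -/
def eq (x y : Fin n) : Larith.BoundedFormula α n := (&x) =' (&y)

/-- for all numbers -/
def allN (φ : Larith.BoundedFormula α (n + 1)) : Larith.BoundedFormula α n :=
  ∀' (num (Fin.last n) ⟹ φ)

/-- there is a number -/
def exN (φ : Larith.BoundedFormula α (n + 1)) : Larith.BoundedFormula α n :=
  ∃' (num (Fin.last n) ⊓ φ)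

/-- for all sets of numbers -/
def allS (φ : Larith.BoundedFormula α (n + 1)) : Larith.BoundedFormula α n :=
  ∀' (∼(num (Fin.last n)) ⟹ φ)

/-- there is a set of numbers -/
def exS (φ : Larith.BoundedFormula α (n + 1)) : Larith.BoundedFormula α n :=
  ∃' (∼(num (Fin.last n)) ⊓ φ)

/-- `(x, y) ∈ z`, where `(x, y)` is the number `(x + y) · (x + y) + x` -/
def pairMem (x y z : Fin n) : Larith.BoundedFormula α n :=
  exN (exN (exN (add x.castSucc.castSucc.castSucc y.castSucc.castSucc.castSucc
        (Fin.last n).castSucc.castSucc ⊓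
    mul (Fin.last n).castSucc.castSucc (Fin.last n).castSucc.castSucc
        (Fin.last (n + 1)).castSucc ⊓
    add (Fin.last (n + 1)).castSucc x.castSucc.castSucc.castSucc (Fin.last (n + 2)) ⊓
    mem (Fin.last (n + 2)) z.castSucc.castSucc.castSucc)))

/-- `0` and `1` are numbers, `+`, `·`, `<` concern numbers only, and only numbers belong to
sets and only sets have elements. -/
def sorts : Larith.Sentence :=
  ∀' ∀' ∀' ((zero 0 ⟹ num 0) ⊓ (one 0 ⟹ num 0) ⊓
    (add 0 1 2 ⟹ (num 0 ⊓ num 1 ⊓ num 2)) ⊓ (mul 0 1 2 ⟹ (num 0 ⊓ num 1 ⊓ num 2)) ⊓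
    (lt 0 1 ⟹ (num 0 ⊓ num 1)) ⊓ (mem 0 1 ⟹ (num 0 ⊓ ∼(num 1))))

def zeroUnique : Larith.Sentence := ∃' ∀' (zero 1 ⇔ eq 1 0)

def oneUnique : Larith.Sentence := ∃' ∀' (one 1 ⇔ eq 1 0)

def addFunctional : Larith.Sentence := allN (allN (∃' ∀' (add 0 1 3 ⇔ eq 3 2)))

def mulFunctional : Larith.Sentence := allN (allN (∃' ∀' (mul 0 1 3 ⇔ eq 3 2)))

def extensionality : Larith.Sentence :=
  allS (allS ((allN (mem 2 0 ⇔ mem 2 1)) ⟹ eq 0 1))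

/-- `n + 1 ≠ 0` -/
def succNeZero : Larith.Sentence :=
  allN (allN (allN ((one 1 ⊓ add 0 1 2) ⟹ ∼(zero 2))))

/-- `m + 1 = n + 1 → m = n` -/
def succInj : Larith.Sentence :=
  allN (allN (allN (allN ((one 2 ⊓ add 0 2 3 ⊓ add 1 2 3) ⟹ eq 0 1))))

/-- `m + 0 = m` -/
def addZero : Larith.Sentence :=
  allN (allN (zero 1 ⟹ add 0 1 0))

/-- `m + (n + 1) = (m + n) + 1` -/
def addSucc : Larith.Sentence :=
  allN (allN (allN (allN (allN (allN
    ((one 2 ⊓ add 1 2 3 ⊓ add 0 1 4 ⊓ add 4 2 5) ⟹ add 0 3 5))))))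

/-- `m · 0 = 0` -/
def mulZero : Larith.Sentence :=
  allN (allN (zero 1 ⟹ mul 0 1 1))

/-- `m · (n + 1) = m · n + m` -/
def mulSucc : Larith.Sentence :=
  allN (allN (allN (allN (allN (allN
    ((one 2 ⊓ add 1 2 3 ⊓ mul 0 1 4 ⊓ add 4 0 5) ⟹ mul 0 3 5))))))

/-- `¬ m < 0` -/
def notLtZero : Larith.Sentence :=
  allN (allN (zero 1 ⟹ ∼(lt 0 1)))

/-- `m < n + 1 ↔ m < n ∨ m = n` -/
def ltSucc : Larith.Sentence :=
  allN (allN (allN (allN ((one 2 ⊓ add 1 2 3) ⟹ (lt 0 3 ⇔ (lt 0 1 ⊔ eq 0 1))))))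

/-- `0 ∈ X ∧ ∀ n, (n ∈ X → n + 1 ∈ X) → ∀ n, n ∈ X` -/
def induction : Larith.Sentence :=
  allS (((allN (zero 1 ⟹ mem 1 0)) ⊓
      (allN (allN (allN ((mem 1 0 ⊓ one 2 ⊓ add 1 2 3) ⟹ mem 3 0))))) ⟹
    allN (mem 1 0))

/-- There is `X` with `m ∈ X ↔ φ(m)` for all `m`. -/
def comprehension (φ : Larith.Formula (Fin n ⊕ Fin 1)) : Larith.Sentence :=
  univClosure (exS (allN (mem 1 0 ⇔ inst φ ![1])))

/-- If for every `m` there is `Y` with `φ(m, Y)`, then there is `Z` such that `φ(m, (Z)_m)` for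
every `m`, where `(Z)_m = {i | (i, m) ∈ Z}`. -/
def choice (φ : Larith.Formula (Fin n ⊕ Fin 2)) : Larith.Sentence :=
  univClosure ((allN (exS (inst φ ![0, 1]))) ⟹
    exS (allN (exS ((allN (mem 3 2 ⇔ pairMem 3 1 0)) ⊓ inst φ ![1, 2]))))

end ArithAxiom

/-- Second order arithmetic with full comprehension and the full choice scheme. -/
inductive SOA : Larith.Theory
  | sorts : SOA ArithAxiom.sorts
  | zeroUnique : SOA ArithAxiom.zeroUnique
  | oneUnique : SOA ArithAxiom.oneUnique
  | addFunctional : SOA ArithAxiom.addFunctional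
  | mulFunctional : SOA ArithAxiom.mulFunctional
  | extensionality : SOA ArithAxiom.extensionality
  | succNeZero : SOA ArithAxiom.succNeZero
  | succInj : SOA ArithAxiom.succInj
  | addZero : SOA ArithAxiom.addZero
  | addSucc : SOA ArithAxiom.addSucc
  | mulZero : SOA ArithAxiom.mulZero
  | mulSucc : SOA ArithAxiom.mulSucc
  | notLtZero : SOA ArithAxiom.notLtZero
  | ltSucc : SOA ArithAxiom.ltSucc
  | induction : SOA ArithAxiom.induction
  | comprehension {n : ℕ} (φ : Larith.Formula (Fin n ⊕ Fin 1)) : SOA (ArithAxiom.comprehension φ)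
  | choice {n : ℕ} (φ : Larith.Formula (Fin n ⊕ Fin 2)) : SOA (ArithAxiom.choice φ)

/-! ### Ordinal definability -/

/-- The universe of sets, as a structure for the language of set theory. -/
instance : Lset.Structure ZFSet.{u} where
  funMap f := isEmptyElim f
  RelMap {_} R := match R with
    | .mem => fun x => x 0 ∈ x 1

/-- `x` is ordinal definable: some formula of set theory with von Neumann ordinals as
parameters holds in the universe of `x` and of nothing else. -/
def OrdinalDefinable (x : ZFSet.{u}) : Prop :=
  (Set.range Ordinal.toZFSet.{u}).Definable₁ Lset {x}

/-- The set of reals `ℝ = 𝒫(ω)`. -/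
def realSet : ZFSet.{u} := ZFSet.powerset ZFSet.omega

/-- `R`, as a set of ordered pairs, is a relation on `A`. -/
def IsRelationOn (R A : ZFSet.{u}) : Prop := R ⊆ ZFSet.prod A A

/-- The relation on the elements of `A` that `R` codes. -/
def codedRel (R A : ZFSet.{u}) (a b : A) : Prop := ZFSet.pair a.1 b.1 ∈ R

/-- Every ordinal definable (strict) well-ordering of a set of reals has order type less
than `ω₁`. -/
def ShortODWellOrderings : Prop :=
  ∀ (A R : ZFSet.{u}), A ⊆ realSet → IsRelationOn R A → OrdinalDefinable R →
    ∀ [IsWellOrder A (codedRel R A)], Ordinal.type (codedRel R A) < ω₁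

end SOAZFC

open SOAZFC

/-! Apply `t` to the standard model of SOA, whose objects are the natural numbers and all sets of
them, coded by subsets of ω. The result M is a model of ZFC_count, and `s` recovers the standard
model from M exactly. The contradiction is that the ordinals of M form an ordinal definable
well-ordering, of uncountable type, of a set of reals.

Equality of structures forces M to live on the same reals. An element of s(t(A)) is a tuple of
tuples of elements of A; if either dimension exceeded 1, every element of A would yield another one
of smaller rank. So both dimensions are 1 and the domains agree
(`Translation.app_dom_eq_of_app_app`). Identity in M is true identity, because a formula over M
cannot separate M-identical objects, yet `s.eqF` defines true identity
(`Translation.app_eq_iff_of_app_app`).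

M is well-founded although this is not first-order. In the standard model an ω-sequence of objects
is coded by two sets of numbers, so the relation between the terms of two sequences is definable
with parameters (`realize_codedRelation`), and `s` carries the definition over to M. Separation and
Collection then make the range of every external sequence a set of M (`exists_set_of_range`). Hence
a descending chain would contradict Foundation (`wellFounded_E`), and an enumeration of the ordinals
of M by ω would give the Burali-Forti paradox (`uncountable_ord`).

The coded standard model is definable in V without parameters, hence so are M and the ordering of
its ordinals (`stdModel_isVDef`, `Translation.app_isVDef`, `ordinalDefinable_ordRel`). The
hypothesis then makes the ordinals of M countable, which they are not. -/

namespace SOAZFC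

/-! ### Transfer to first-order structures on types -/

section Transfer

variable {L : FirstOrder.Language.{0, 0}} [L.IsRelational]

theorem realize_termVar {N : Type*} [L.Structure N] {β : Type} (t : L.Term β) (v : β → N) :
    t.realize v = v (termVar t) := by
  cases t with
  | var b => rfl
  | func f _ => exact isEmptyElim f

/-- Bridge from `Sat` to Mathlib's `Realize`: a bijection `c` of a type with the domain, under which
identity is true identity, transports satisfaction. One carrier `N` can then bear structures for
both languages. -/
theorem SetStructure.sat_iff_realize {N : Type} [L.Structure N] {A : SetStructure.{u} L}
    {c : N → ZFSet.{u}} (hdom : ∀ z, z ∈ A.dom ↔ ∃ a, c a = z)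
    (heq : ∀ a b, A.eq (c a) (c b) ↔ a = b)
    (hrel : ∀ {k : ℕ} (R : L.Relations k) (x : Fin k → N),
      A.rel R (fun i => c (x i)) ↔ Structure.RelMap R x)
    {α : Type} {n : ℕ} (φ : L.BoundedFormula α n) (v : α → N) (xs : Fin n → N) :
    A.Sat φ (c ∘ v) (c ∘ xs) ↔ φ.Realize v xs := by
  induction φ with
  | falsum => rfl
  | equal t₁ t₂ =>
    simp only [SetStructure.Sat, BoundedFormula.Realize, realize_termVar, ← Sum.comp_elim]
    exact heq _ _
  | rel R ts =>
    simp only [SetStructure.Sat, BoundedFormula.Realize, realize_termVar, ← Sum.comp_elim]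
    exact hrel _ _
  | imp φ ψ ih₁ ih₂ => simp only [SetStructure.Sat, BoundedFormula.Realize, ih₁, ih₂]
  | all φ ih =>
    simp only [SetStructure.Sat, BoundedFormula.Realize, hdom]
    constructor
    · intro h a
      rw [← ih, Fin.comp_snoc]
      exact h _ ⟨a, rfl⟩
    · rintro h _ ⟨a, rfl⟩
      rw [← Fin.comp_snoc, ih]
      exact h a

theorem SetStructure.satFormula_iff_realize {N : Type} [L.Structure N] {A : SetStructure.{u} L}
    {c : N → ZFSet.{u}} (hdom : ∀ z, z ∈ A.dom ↔ ∃ a, c a = z)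
    (heq : ∀ a b, A.eq (c a) (c b) ↔ a = b)
    (hrel : ∀ {k : ℕ} (R : L.Relations k) (x : Fin k → N),
      A.rel R (fun i => c (x i)) ↔ Structure.RelMap R x)
    {α : Type} (φ : L.Formula α) (v : α → N) :
    A.SatFormula φ (fun a => c (v a)) ↔ φ.Realize v := by
  rw [Formula.Realize, ← A.sat_iff_realize hdom heq hrel, SetStructure.SatFormula]
  exact iff_of_eq (congrArg _ (Subsingleton.elim _ _))

theorem SetStructure.satFormula_iff_models {N : Type} [L.Structure N] {A : SetStructure.{u} L}
    {c : N → ZFSet.{u}} (hdom : ∀ z, z ∈ A.dom ↔ ∃ a, c a = z)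
    (heq : ∀ a b, A.eq (c a) (c b) ↔ a = b)
    (hrel : ∀ {k : ℕ} (R : L.Relations k) (x : Fin k → N),
      A.rel R (fun i => c (x i)) ↔ Structure.RelMap R x) (φ : L.Sentence) :
    A.SatFormula φ Empty.elim ↔ N ⊨ φ := by
  rw [Sentence.Realize, ← A.satFormula_iff_realize hdom heq hrel]
  exact iff_of_eq (congrArg _ (Subsingleton.elim _ _))

end Transfer

theorem realize_inst {L : FirstOrder.Language.{0, 0}} {N : Type*} [L.Structure N] {α : Type}
    {k m : ℕ} (φ : L.Formula (α ⊕ Fin k)) (σ : Fin k → Fin m) (v : α → N) (xs : Fin m → N) :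
    (inst φ σ).Realize v xs ↔ φ.Realize (Sum.elim v (xs ∘ σ)) := by
  rw [inst]
  erw [BoundedFormula.realize_relabel]
  rw [Formula.Realize]
  have h1 : Sum.elim v (xs ∘ Fin.castAdd 0) ∘ Sum.map id σ = Sum.elim v (xs ∘ σ) := by
    funext i; cases i <;> rfl
  rw [h1]
  exact iff_of_eq (congrArg _ (Subsingleton.elim _ _))

theorem realize_univClosure {L : FirstOrder.Language.{0, 0}} {N : Type*} [L.Structure N]
    {n : ℕ} (ψ : L.Formula (Fin n)) :
    N ⊨ univClosure ψ ↔ ∀ p : Fin n → N, ψ.Realize p := by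
  refine (BoundedFormula.realize_alls (v := (default : Empty → N))).trans (forall_congr' fun p => ?_)
  exact Formula.realize_relabel_sumInr ψ (v := default) (x := p)

/-! ### Set theory in a model -/

section Model

variable {N : Type} [Lset.Structure N]

/-- The membership relation of a structure for the language of set theory. -/
def E (x y : N) : Prop := Structure.RelMap SetAxiom.memSymbol ![x, y]

@[simp]
theorem realize_mem {α : Type} {n : ℕ} (x y : Fin n) (v : α → N) (xs : Fin n → N) :
    (SetAxiom.mem x y : Lset.BoundedFormula α n).Realize v xs ↔ E (xs x) (xs y) := by
  simp [SetAxiom.mem, BoundedFormula.realize_rel₂, E]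

@[simp]
theorem realize_eq {α : Type} {n : ℕ} (x y : Fin n) (v : α → N) (xs : Fin n → N) :
    (SetAxiom.eq x y : Lset.BoundedFormula α n).Realize v xs ↔ xs x = xs y := by
  simp [SetAxiom.eq]

variable (hN : ∀ φ ∈ ZFCcount, N ⊨ φ)
include hN

theorem model_ext {x y : N} (h : ∀ z, E z x ↔ E z y) : x = y := by
  have := hN _ ZFCcount.extensionality
  simp [SetAxiom.extensionality, Sentence.Realize, Formula.Realize, Fin.snoc] at this
  exact this x y h

theorem model_foundation {x y : N} (h : E y x) : ∃ y, E y x ∧ ∀ z, E z y → ¬ E z x := by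
  have := hN _ ZFCcount.foundation
  simp [SetAxiom.foundation, Sentence.Realize, Formula.Realize, Fin.snoc] at this
  exact this x y h

theorem model_pairing (x y : N) : ∃ z, ∀ a, E a z ↔ a = x ∨ a = y := by
  have := hN _ ZFCcount.pairing
  simp [SetAxiom.pairing, SetAxiom.isUPair, Sentence.Realize, Formula.Realize, Fin.snoc] at this
  exact this x y

theorem model_infinity : ∃ w : N, (∃ o, (∀ z, ¬ E z o) ∧ E o w) ∧
    ∀ x, E x w → ∃ y, (∀ z, E z y ↔ E z x ∨ z = x) ∧ E y w := by
  have := hN _ ZFCcount.infinity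
  simp [SetAxiom.infinity, SetAxiom.isInductive, SetAxiom.isEmpty, SetAxiom.isSucc,
    Sentence.Realize, Formula.Realize, Fin.snoc] at this
  exact this

theorem model_separation {n : ℕ} (φ : Lset.Formula (Fin n ⊕ Fin 1)) (p : Fin n → N) (a : N) :
    ∃ b, ∀ x, E x b ↔ E x a ∧ φ.Realize (Sum.elim p ![x]) := by
  have := hN _ (ZFCcount.separation φ)
  simp only [SetAxiom.separation, realize_univClosure] at this
  have := this p
  simp [Formula.Realize, realize_inst, Fin.snoc] at this
  have key : ∀ (xs : Fin 3 → N), xs ∘ ![2] = ![xs 2] := by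
    intro xs; funext i; fin_cases i; rfl
  simp only [key] at this
  exact this a

theorem model_collection {n : ℕ} (φ : Lset.Formula (Fin n ⊕ Fin 2)) (p : Fin n → N) (a : N)
    (h : ∀ x, E x a → ∃ y, φ.Realize (Sum.elim p ![x, y])) :
    ∃ b, ∀ x, E x a → ∃ y, E y b ∧ φ.Realize (Sum.elim p ![x, y]) := by
  have := hN _ (ZFCcount.collection φ)
  simp only [SetAxiom.collection, realize_univClosure] at this
  have := this p
  simp [Formula.Realize, realize_inst, Fin.snoc] at this
  have key : ∀ (xs : Fin 3 → N), xs ∘ ![1, 2] = ![xs 1, xs 2] := by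
    intro xs; funext i; fin_cases i <;> rfl
  have key' : ∀ (xs : Fin 4 → N), xs ∘ ![2, 3] = ![xs 2, xs 3] := by
    intro xs; funext i; fin_cases i <;> rfl
  simp only [key, key'] at this
  exact this a h

/-- Foundation for the singleton of `x`. -/
theorem model_not_mem_self (x : N) : ¬ E x x := by
  intro h
  obtain ⟨z, hz⟩ := model_pairing hN x x
  obtain ⟨y, hy, hy'⟩ := model_foundation hN ((hz x).2 (Or.inl rfl))
  obtain rfl : y = x := by simpa using (hz y).1 hy
  exact hy' y h hy

/-! ### External countable sequences and well-foundedness -/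

omit hN in
/-- The range of every sequence of pairs is first-order definable with parameters. -/
def CountableRelationsDefinable (N : Type) [Lset.Structure N] : Prop :=
  ∀ f g : ℕ → N, ∃ (m : ℕ) (φ : Lset.Formula (Fin m ⊕ Fin 2)) (p : Fin m → N),
    ∀ x y, φ.Realize (Sum.elim p ![x, y]) ↔ ∃ k, f k = x ∧ g k = y

variable (hC : CountableRelationsDefinable N)
include hC

theorem model_separation_range (f : ℕ → N) (a : N) :
    ∃ b, ∀ x, E x b ↔ E x a ∧ ∃ k, f k = x := by
  -- The relation of `f` with itself is the diagonal of its range, so identifying the two variables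
  -- of `φ` defines the range.
  obtain ⟨m, φ, p, hφ⟩ := hC f f
  obtain ⟨b, hb⟩ := model_separation hN
    (φ.relabel (Sum.map id (fun _ => 0) : Fin m ⊕ Fin 2 → Fin m ⊕ Fin 1)) p a
  refine ⟨b, fun x => (hb x).trans (and_congr_right fun _ => ?_)⟩
  rw [Formula.realize_relabel]
  have : Sum.elim p ![x] ∘ Sum.map id (fun _ => 0) = Sum.elim p ![x, x] := by
    funext i
    rcases i with i | i
    · rfl
    · fin_cases i <;> rfl
  rw [this, hφ]
  simp

omit hC in
-- Iterate the successor from ∅ inside an inductive set. Earlier terms belong to later ones, so a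
-- repetition would give a self-membered set. The sequence serves as an index set for Collection.
theorem exists_injective_sequence : ∃ (w : N) (e : ℕ → N), e.Injective ∧ ∀ k, E (e k) w := by
  obtain ⟨w, ⟨o, -, how⟩, hs⟩ := model_infinity hN
  choose s hs hs' using hs
  let e : ℕ → {x // E x w} := fun k => k.rec ⟨o, how⟩ fun _ x => ⟨s x x.2, hs' x x.2⟩
  have he : ∀ k z, E z (e (k + 1)).1 ↔ E z (e k).1 ∨ z = (e k).1 := fun k => hs _ _
  have hlt : ∀ i j, i < j → E (e i).1 (e j).1 := by
    intro i j hij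
    induction j, hij using Nat.le_induction with
    | base => exact (he i _).2 (Or.inr rfl)
    | succ j _ ih => exact (he j _).2 (Or.inl ih)
  refine ⟨w, fun k => (e k).1, fun i j hij => ?_, fun k => (e k).2⟩
  dsimp only at hij
  rcases lt_trichotomy i j with h | h | h
  · exact absurd (hij ▸ hlt i j h) (model_not_mem_self hN _)
  · exact h
  · exact absurd (hij ▸ hlt j i h) (model_not_mem_self hN _)

/-- Replacement for external sequences: the terms of `e` form a set, and Collection is applied to
the definable relation that sends `e k` to `f k`. -/
theorem exists_set_of_range (f : ℕ → N) : ∃ b : N, ∀ y, E y b ↔ ∃ k, f k = y := by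
  obtain ⟨w, e, he, hew⟩ := exists_injective_sequence hN
  obtain ⟨a, ha⟩ := model_separation_range hN hC e w
  obtain ⟨m, φ, p, hφ⟩ := hC e f
  obtain ⟨b, hb⟩ := model_collection hN φ p a (by
    intro x hx
    obtain ⟨-, k, rfl⟩ := (ha x).1 hx
    exact ⟨f k, (hφ _ _).2 ⟨k, rfl, rfl⟩⟩)
  -- Collection may put too much into `b`; separation keeps the terms of `f`. None is missing,
  -- because `e` is injective and so `f k` is the only value at `e k`.
  obtain ⟨d, hd⟩ := model_separation_range hN hC f b
  refine ⟨d, fun y => (hd y).trans (and_iff_right_of_imp ?_)⟩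
  rintro ⟨k, rfl⟩
  obtain ⟨y, hyb, hy⟩ := hb (e k) ((ha _).2 ⟨hew k, k, rfl⟩)
  obtain ⟨i, hi, rfl⟩ := (hφ _ _).1 hy
  rwa [he hi] at hyb

/-- The range of a descending chain would be a set of the model without a minimal element. -/
theorem wellFounded_E : WellFounded (E : N → N → Prop) := by
  rw [wellFounded_iff_isEmpty_descending_chain]
  refine ⟨fun ⟨f, hf⟩ => ?_⟩
  obtain ⟨b, hb⟩ := exists_set_of_range hN hC f
  obtain ⟨y, hy, hy'⟩ := model_foundation hN ((hb _).2 ⟨0, rfl⟩)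
  obtain ⟨k, rfl⟩ := (hb y).1 hy
  exact hy' _ (hf k) ((hb _).2 ⟨k + 1, rfl⟩)

/-! ### The ordinals of the model -/

omit hN hC in
/-- `x` is an ordinal of the model: a transitive set of transitive sets. -/
def IsOrd (x : N) : Prop :=
  (∀ y z, E y x → E z y → E z x) ∧ ∀ y z w, E y x → E z y → E w z → E w y

omit hN hC in
theorem IsOrd.of_mem {x y : N} (hx : IsOrd x) (h : E y x) : IsOrd y :=
  ⟨fun z w => hx.2 y z w h, fun z w v hz => hx.2 z w v (hx.1 y z h hz)⟩

/-- Double induction along `E`: if neither ordinal contains all elements of the other, compare a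
witness of this with the other ordinal and use transitivity. -/
theorem IsOrd.trichotomy {x y : N} (hx : IsOrd x) (hy : IsOrd y) : E x y ∨ x = y ∨ E y x := by
  induction x using (wellFounded_E hN hC).induction generalizing y with
  | _ x ihx =>
  induction y using (wellFounded_E hN hC).induction with
  | _ y ihy =>
  by_cases h₁ : ∀ z, E z x → E z y
  · by_cases h₂ : ∀ z, E z y → E z x
    · exact Or.inr (Or.inl (model_ext hN fun z => ⟨h₁ z, h₂ z⟩))
    · push Not at h₂
      obtain ⟨z, hzy, hzx⟩ := h₂
      rcases ihy z hzy (hy.of_mem hzy) with h | rfl | h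
      · exact Or.inl (hy.1 z x hzy h)
      · exact Or.inl hzy
      · exact absurd h hzx
  · push Not at h₁
    obtain ⟨z, hzx, hzy⟩ := h₁
    rcases ihx z hzx (hx.of_mem hzx) hy with h | rfl | h
    · exact absurd h hzy
    · exact Or.inr (Or.inr hzx)
    · exact Or.inr (Or.inr (hx.1 z y hzx h))

theorem isWellOrder_ord : IsWellOrder {x : N // IsOrd x} fun x y => E x.1 y.1 where
  wf := InvImage.wf Subtype.val (wellFounded_E hN hC)
  trichotomous x y h₁ h₂ := by
    rcases x.2.trichotomy hN hC y.2 with h | h | h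
    · exact absurd h h₁
    · exact Subtype.ext h
    · exact absurd h h₂

/-- Burali-Forti: if an external sequence exhausted the ordinals, its range would be a set of the
model, hence an ordinal, hence an element of itself. -/
theorem uncountable_ord : ¬ Countable {x : N // IsOrd x} := by
  intro hc
  obtain ⟨w, ⟨o, ho, -⟩, -⟩ := model_infinity hN
  -- A surjection from ℕ needs a non-empty target; the empty set of the model is an ordinal.
  have : Nonempty {x : N // IsOrd x} :=
    ⟨o, fun y _ h => absurd h (ho y), fun y _ _ h => absurd h (ho y)⟩
  obtain ⟨f, hf⟩ := exists_surjective_nat {x : N // IsOrd x}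
  obtain ⟨b, hb⟩ := exists_set_of_range hN hC fun k => (f k).1
  have hb' : ∀ y, E y b ↔ IsOrd y := fun y => (hb y).trans
    ⟨fun ⟨k, hk⟩ => hk ▸ (f k).2, fun hy => (hf ⟨y, hy⟩).imp fun _ h => congrArg Subtype.val h⟩
  refine model_not_mem_self hN b ((hb' b).2 ⟨fun y z hy hz => ?_, fun y z v hy => ?_⟩)
  · exact (hb' z).2 (((hb' y).1 hy).of_mem hz)
  · exact ((hb' y).1 hy).1 z v

end Model

/-! ### The standard model of second order arithmetic -/

/-- The objects of the standard model of second order arithmetic. -/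
abbrev Std : Type := ℕ ⊕ Set ℕ

instance : Larith.Structure Std where
  funMap f := isEmptyElim f
  RelMap {_} R := match R with
    | .num => fun x => ∃ n, x 0 = .inl n
    | .zero => fun x => x 0 = .inl 0
    | .one => fun x => x 0 = .inl 1
    | .add => fun x => ∃ m n, x 0 = .inl m ∧ x 1 = .inl n ∧ x 2 = .inl (m + n)
    | .mul => fun x => ∃ m n, x 0 = .inl m ∧ x 1 = .inl n ∧ x 2 = .inl (m * n)
    | .lt => fun x => ∃ m n, x 0 = .inl m ∧ x 1 = .inl n ∧ m < n
    | .mem => fun x => ∃ m X, x 0 = .inl m ∧ x 1 = .inr X ∧ m ∈ X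

namespace ArithAxiom

variable {α : Type} {n : ℕ} (v : α → Std) (xs : Fin n → Std)

@[simp]
theorem realize_num (x : Fin n) :
    (num x : Larith.BoundedFormula α n).Realize v xs ↔ ∃ i, xs x = .inl i := by
  simp only [num, BoundedFormula.realize_rel₁]; rfl

@[simp]
theorem realize_zero (x : Fin n) :
    (zero x : Larith.BoundedFormula α n).Realize v xs ↔ xs x = .inl 0 := by
  simp only [zero, BoundedFormula.realize_rel₁]; rfl

@[simp]
theorem realize_one (x : Fin n) :
    (one x : Larith.BoundedFormula α n).Realize v xs ↔ xs x = .inl 1 := by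
  simp only [one, BoundedFormula.realize_rel₁]; rfl

@[simp]
theorem realize_add (x y z : Fin n) :
    (add x y z : Larith.BoundedFormula α n).Realize v xs ↔
      ∃ i j, xs x = .inl i ∧ xs y = .inl j ∧ xs z = .inl (i + j) := by
  simp only [add, BoundedFormula.realize_rel]; rfl

@[simp]
theorem realize_mul (x y z : Fin n) :
    (mul x y z : Larith.BoundedFormula α n).Realize v xs ↔
      ∃ i j, xs x = .inl i ∧ xs y = .inl j ∧ xs z = .inl (i * j) := by
  simp only [mul, BoundedFormula.realize_rel]; rfl

@[simp]
theorem realize_lt (x y : Fin n) :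
    (lt x y : Larith.BoundedFormula α n).Realize v xs ↔
      ∃ i j, xs x = .inl i ∧ xs y = .inl j ∧ i < j := by
  simp only [lt, BoundedFormula.realize_rel₂]; rfl

@[simp]
theorem realize_mem (x y : Fin n) :
    (mem x y : Larith.BoundedFormula α n).Realize v xs ↔
      ∃ i X, xs x = .inl i ∧ xs y = .inr X ∧ i ∈ X := by
  simp only [mem, BoundedFormula.realize_rel₂]; rfl

@[simp]
theorem realize_eq (x y : Fin n) :
    (eq x y : Larith.BoundedFormula α n).Realize v xs ↔ xs x = xs y := by
  simp [eq]

@[simp]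
theorem realize_allN (φ : Larith.BoundedFormula α (n + 1)) :
    (allN φ).Realize v xs ↔ ∀ i, φ.Realize v (Fin.snoc xs (.inl i)) := by
  simp [allN]

@[simp]
theorem realize_exN (φ : Larith.BoundedFormula α (n + 1)) :
    (exN φ).Realize v xs ↔ ∃ i, φ.Realize v (Fin.snoc xs (.inl i)) := by
  simp [exN]

@[simp]
theorem realize_allS (φ : Larith.BoundedFormula α (n + 1)) :
    (allS φ).Realize v xs ↔ ∀ X, φ.Realize v (Fin.snoc xs (.inr X)) := by
  simp [allS]

@[simp]
theorem realize_exS (φ : Larith.BoundedFormula α (n + 1)) :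
    (exS φ).Realize v xs ↔ ∃ X, φ.Realize v (Fin.snoc xs (.inr X)) := by
  simp [exS]

@[simp]
theorem realize_pairMem (x y z : Fin n) :
    (pairMem x y z : Larith.BoundedFormula α n).Realize v xs ↔
      ∃ i j X, xs x = .inl i ∧ xs y = .inl j ∧ xs z = .inr X ∧ (i + j) * (i + j) + i ∈ X := by
  simp only [pairMem, realize_exN, BoundedFormula.realize_inf, realize_add, realize_mul,
    realize_mem, Fin.snoc_castSucc, Fin.snoc_last]
  constructor
  · rintro ⟨a, b, c, ⟨⟨⟨i, j, hi, hj, ha⟩, k, l, hk, hl, hb⟩, p, q, hp, hq, hc⟩, r, X, hr, hX, hrX⟩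
    simp only [Sum.inl.injEq] at ha hk hl hb hp hc hr
    subst ha hk hl hb hp hc
    obtain rfl : q = i := by simpa [hi] using hq.symm
    subst hr
    exact ⟨_, _, _, hi, hj, hX, hrX⟩
  · rintro ⟨i, j, X, hi, hj, hX, h⟩
    exact ⟨i + j, _, _, ⟨⟨⟨i, j, hi, hj, rfl⟩, _, _, rfl, rfl, rfl⟩, _, _, rfl, hi, rfl⟩,
      _, _, rfl, hX, h⟩

end ArithAxiom

/-- The code of a pair of natural numbers. -/
def pairCode (i j : ℕ) : ℕ := (i + j) * (i + j) + i

/-- The code lies between (i + j)² and (i + j + 1)², the latter excluded, so it determines i + j and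
then i. -/
theorem pairCode_inj {i j i' j' : ℕ} (h : pairCode i j = pairCode i' j') : i = i' ∧ j = j' := by
  unfold pairCode at h
  have : i + j = i' + j' := by
    rcases lt_trichotomy (i + j) (i' + j') with h' | h' | h'
    · nlinarith
    · exact h'
    · nlinarith
  rw [this] at h
  omega

theorem std_comprehension {n : ℕ} (φ : Larith.Formula (Fin n ⊕ Fin 1)) :
    Std ⊨ ArithAxiom.comprehension φ := by
  simp only [ArithAxiom.comprehension, realize_univClosure]
  intro p
  simp only [Formula.Realize, ArithAxiom.realize_exS, ArithAxiom.realize_allN,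
    BoundedFormula.realize_iff, realize_inst, ArithAxiom.realize_mem]
  refine ⟨{i | φ.Realize (Sum.elim p ![.inl i])}, fun i => ?_⟩
  have : ∀ xs : Fin 2 → Std, xs ∘ ![1] = ![xs 1] := by
    intro xs; funext i; fin_cases i; rfl
  simp only [this]
  simp [Fin.snoc, Formula.Realize]

theorem std_choice {n : ℕ} (φ : Larith.Formula (Fin n ⊕ Fin 2)) :
    Std ⊨ ArithAxiom.choice φ := by
  simp only [ArithAxiom.choice, realize_univClosure]
  intro p
  have h₁ : ∀ xs : Fin 2 → Std, xs ∘ ![0, 1] = ![xs 0, xs 1] := by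
    intro xs; funext i; fin_cases i <;> rfl
  have h₂ : ∀ xs : Fin 3 → Std, xs ∘ ![1, 2] = ![xs 1, xs 2] := by
    intro xs; funext i; fin_cases i <;> rfl
  simp only [Formula.Realize, ArithAxiom.realize_exS, ArithAxiom.realize_allN,
    BoundedFormula.realize_iff, BoundedFormula.realize_imp, BoundedFormula.realize_inf,
    realize_inst, ArithAxiom.realize_mem, ArithAxiom.realize_pairMem, h₁, h₂]
  intro h
  choose Y hY using h
  -- The externally chosen sets `Y m` are glued into one set with sections `Y m`; every set of
  -- numbers is available in the standard model.
  refine ⟨{k | ∃ i m, k = pairCode i m ∧ i ∈ Y m}, fun m => ⟨Y m, fun i => ?_, hY m⟩⟩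
  constructor
  · rintro ⟨i', X, hi, hX, h⟩
    obtain rfl : i = i' := Sum.inl_injective hi
    obtain rfl : Y m = X := Sum.inr_injective hX
    exact ⟨i, m, _, rfl, rfl, rfl, i, m, rfl, h⟩
  · rintro ⟨i', m', X, hi, hm, hX, h⟩
    obtain rfl : i = i' := Sum.inl_injective hi
    obtain rfl : m = m' := Sum.inl_injective hm
    obtain rfl := Sum.inr_injective hX
    obtain ⟨i', m', h, h'⟩ := h
    obtain ⟨rfl, rfl⟩ := pairCode_inj h
    exact ⟨i, Y m, rfl, rfl, h'⟩

theorem std_induction : Std ⊨ ArithAxiom.induction := by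
  simp only [ArithAxiom.induction, Sentence.Realize, Formula.Realize, ArithAxiom.realize_allS,
    ArithAxiom.realize_allN, BoundedFormula.realize_imp, BoundedFormula.realize_inf,
    ArithAxiom.realize_mem, ArithAxiom.realize_zero, ArithAxiom.realize_one,
    ArithAxiom.realize_add]
  simp [Fin.snoc]
  intro X h₀ h₁ k
  induction k with
  | zero => exact h₀
  | succ k ih => exact h₁ _ _ _ ih rfl rfl

theorem std_sorts : Std ⊨ ArithAxiom.sorts := by
  simp only [ArithAxiom.sorts, Sentence.Realize, Formula.Realize, BoundedFormula.realize_all,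
    BoundedFormula.realize_imp, BoundedFormula.realize_inf, BoundedFormula.realize_not,
    ArithAxiom.realize_mem, ArithAxiom.realize_zero, ArithAxiom.realize_one,
    ArithAxiom.realize_add, ArithAxiom.realize_mul, ArithAxiom.realize_lt, ArithAxiom.realize_num]
  intro a b c
  refine ⟨⟨⟨⟨⟨fun h => ⟨_, h⟩, fun h => ⟨_, h⟩⟩, ?_⟩, ?_⟩, ?_⟩, ?_⟩
  · rintro ⟨i, j, hi, hj, hk⟩
    exact ⟨⟨⟨i, hi⟩, j, hj⟩, _, hk⟩
  · rintro ⟨i, j, hi, hj, hk⟩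
    exact ⟨⟨⟨i, hi⟩, j, hj⟩, _, hk⟩
  · rintro ⟨i, j, hi, hj, -⟩
    exact ⟨⟨i, hi⟩, j, hj⟩
  · rintro ⟨i, X, hi, hX, -⟩
    refine ⟨⟨i, hi⟩, ?_⟩
    rintro ⟨j, hj⟩
    rw [hX] at hj
    exact absurd hj Sum.inr_ne_inl

theorem std_models_SOA : ∀ φ ∈ SOA, Std ⊨ φ := by
  intro φ hφ
  cases hφ with
  | comprehension φ => exact std_comprehension φ
  | choice φ => exact std_choice φ
  | induction => exact std_induction
  | sorts => exact std_sorts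
  | zeroUnique =>
    simp [ArithAxiom.zeroUnique, Sentence.Realize, Formula.Realize, Fin.snoc]
  | oneUnique =>
    simp [ArithAxiom.oneUnique, Sentence.Realize, Formula.Realize, Fin.snoc]
  | addFunctional =>
    simp [ArithAxiom.addFunctional, Sentence.Realize, Formula.Realize, Fin.snoc]
  | mulFunctional =>
    simp [ArithAxiom.mulFunctional, Sentence.Realize, Formula.Realize, Fin.snoc]
  | extensionality =>
    simp [ArithAxiom.extensionality, Sentence.Realize, Formula.Realize, Fin.snoc]
    exact fun X Y h => Set.ext h
  | succNeZero =>
    simp [ArithAxiom.succNeZero, Sentence.Realize, Formula.Realize, Fin.snoc]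
  | succInj =>
    simp [ArithAxiom.succInj, Sentence.Realize, Formula.Realize, Fin.snoc]
  | addZero =>
    simp [ArithAxiom.addZero, Sentence.Realize, Formula.Realize, Fin.snoc]
  | addSucc =>
    simp [ArithAxiom.addSucc, Sentence.Realize, Formula.Realize, Fin.snoc]
    omega
  | mulZero =>
    simp [ArithAxiom.mulZero, Sentence.Realize, Formula.Realize, Fin.snoc]
  | mulSucc =>
    simp [ArithAxiom.mulSucc, Sentence.Realize, Formula.Realize, Fin.snoc]
    rintro i j _ _ _ _ rfl rfl rfl rfl
    ring
  | notLtZero =>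
    simp [ArithAxiom.notLtZero, Sentence.Realize, Formula.Realize, Fin.snoc]
  | ltSucc =>
    simp [ArithAxiom.ltSucc, Sentence.Realize, Formula.Realize, Fin.snoc]
    exact fun i j => Nat.le_iff_lt_or_eq

/-! ### Countable relations are definable in second order arithmetic -/

/-- `x` is the value at the number `k` of the sequence coded by the sets `Y` and `Z`. -/
def codedValue {α : Type} {n : ℕ} (x k Y Z : Fin n) : Larith.BoundedFormula α n :=
  (ArithAxiom.num x ⇔ ArithAxiom.mem k Y) ⊓
  ArithAxiom.allN ((ArithAxiom.mem (Fin.last n) x.castSucc ⊔ ArithAxiom.eq (Fin.last n) x.castSucc)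
    ⇔ ArithAxiom.pairMem (Fin.last n) k.castSucc Z.castSucc)

/-- The indices of the numbers in a sequence. -/
def numIndices (f : ℕ → Std) : Set ℕ := {k | ∃ i, f k = .inl i}

/-- The contents of the terms of a sequence. -/
def seqCode (f : ℕ → Std) : Set ℕ :=
  {p | ∃ i k, p = pairCode i k ∧ ((∃ X, f k = .inr X ∧ i ∈ X) ∨ f k = .inl i)}

theorem pairCode_mem_seqCode (f : ℕ → Std) (i k : ℕ) :
    (i + k) * (i + k) + i ∈ seqCode f ↔ (∃ X, f k = .inr X ∧ i ∈ X) ∨ f k = .inl i := by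
  constructor
  · rintro ⟨i', k', h, h'⟩
    obtain ⟨rfl, rfl⟩ := pairCode_inj h
    exact h'
  · intro h
    exact ⟨i, k, rfl, h⟩

/-- A number i and the set {i} have the same contents in `seqCode`; the sort recorded in
`numIndices` tells them apart. Sort and contents together determine the object. -/
theorem realize_codedValue {α : Type} {n : ℕ} {v : α → Std} {xs : Fin n → Std} {x k Y Z : Fin n}
    {f : ℕ → Std} {j : ℕ} (hk : xs k = .inl j) (hY : xs Y = .inr (numIndices f))
    (hZ : xs Z = .inr (seqCode f)) :
    (codedValue x k Y Z : Larith.BoundedFormula α n).Realize v xs ↔ f j = xs x := by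
  simp only [codedValue, BoundedFormula.realize_inf, BoundedFormula.realize_iff,
    BoundedFormula.realize_sup, ArithAxiom.realize_num, ArithAxiom.realize_mem,
    ArithAxiom.realize_allN, ArithAxiom.realize_eq, ArithAxiom.realize_pairMem, Fin.snoc_castSucc,
    Fin.snoc_last, hk, hY, hZ]
  have h₁ : ∀ i, (∃ i_1 j_1 X, (Sum.inl i : Std) = .inl i_1 ∧ (Sum.inl j : Std) = .inl j_1 ∧
      (Sum.inr (seqCode f) : Std) = .inr X ∧ (i_1 + j_1) * (i_1 + j_1) + i_1 ∈ X) ↔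
      (∃ X, f j = .inr X ∧ i ∈ X) ∨ f j = .inl i := by
    intro i
    rw [← pairCode_mem_seqCode]
    simp
  have h₂ : (∃ i X, (Sum.inl j : Std) = .inl i ∧ (Sum.inr (numIndices f) : Std) = .inr X ∧ i ∈ X) ↔
      ∃ i, f j = .inl i := by
    simp [numIndices]
  simp only [h₁, h₂]
  rcases xs x with a | A <;> rcases f j with b | B
  · simp
    constructor
    · intro h
      exact ((h a).1 rfl)
    · rintro rfl i
      exact eq_comm
  · simp
  · simp
  · simp [iff_comm]
    rw [← Set.ext_iff, eq_comm]

/-- The relation that consists of the values of two coded sequences. -/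
def codedRelation : Larith.BoundedFormula Empty 6 :=
  -- Variables 0 to 3 are the codes of the two sequences, 4 and 5 the arguments, and 6 the common
  -- index bound by `exN`.
  ArithAxiom.exN (codedValue 4 6 0 1 ⊓ codedValue 5 6 2 3)

theorem realize_codedRelation (f g : ℕ → Std) (v : Empty → Std) (x y : Std) :
    codedRelation.Realize v ![.inr (numIndices f), .inr (seqCode f), .inr (numIndices g),
      .inr (seqCode g), x, y] ↔ ∃ k, f k = x ∧ g k = y := by
  simp only [codedRelation, ArithAxiom.realize_exN, BoundedFormula.realize_inf]
  refine exists_congr fun k => and_congr ?_ ?_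
  · exact realize_codedValue (f := f) (j := k) rfl rfl rfl
  · exact realize_codedValue (f := g) (j := k) rfl rfl rfl

/-! ### Definability in the universe of sets -/

/-- The relation `P` on the universe is first-order definable without parameters. -/
def VDef {n : ℕ} (P : (Fin n → ZFSet.{u}) → Prop) : Prop :=
  ∃ φ : Lset.BoundedFormula Empty n, ∀ v, φ.Realize Empty.elim v ↔ P v

namespace VDef

variable {n : ℕ} {P Q : (Fin n → ZFSet.{u}) → Prop}

theorem congr (h : VDef P) (hPQ : ∀ v, P v ↔ Q v) : VDef Q := by
  obtain ⟨φ, hφ⟩ := h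
  exact ⟨φ, fun v => (hφ v).trans (hPQ v)⟩

theorem mem (i j : Fin n) : VDef fun v : Fin n → ZFSet.{u} => v i ∈ v j :=
  ⟨SetAxiom.mem i j, fun v => by simp only [SetAxiom.mem, BoundedFormula.realize_rel₂]; rfl⟩

theorem eq (i j : Fin n) : VDef fun v : Fin n → ZFSet.{u} => v i = v j :=
  ⟨SetAxiom.eq i j, fun v => by simp [SetAxiom.eq]⟩

theorem false : VDef fun _ : Fin n → ZFSet.{u} => False := ⟨⊥, fun v => by simp⟩

theorem not (h : VDef P) : VDef fun v => ¬ P v := by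
  obtain ⟨φ, hφ⟩ := h
  exact ⟨∼φ, fun v => by simp [hφ]⟩

theorem imp (h : VDef P) (h' : VDef Q) : VDef fun v => P v → Q v := by
  obtain ⟨φ, hφ⟩ := h
  obtain ⟨ψ, hψ⟩ := h'
  exact ⟨φ ⟹ ψ, fun v => by simp [hφ, hψ]⟩

theorem and (h : VDef P) (h' : VDef Q) : VDef fun v => P v ∧ Q v := by
  obtain ⟨φ, hφ⟩ := h
  obtain ⟨ψ, hψ⟩ := h'
  exact ⟨φ ⊓ ψ, fun v => by simp [hφ, hψ]⟩

theorem or (h : VDef P) (h' : VDef Q) : VDef fun v => P v ∨ Q v := by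
  obtain ⟨φ, hφ⟩ := h
  obtain ⟨ψ, hψ⟩ := h'
  exact ⟨φ ⊔ ψ, fun v => by simp [hφ, hψ]⟩

theorem iff (h : VDef P) (h' : VDef Q) : VDef fun v => P v ↔ Q v := by
  obtain ⟨φ, hφ⟩ := h
  obtain ⟨ψ, hψ⟩ := h'
  exact ⟨φ ⇔ ψ, fun v => by simp [hφ, hψ]⟩

theorem all {P : (Fin n → ZFSet.{u}) → ZFSet.{u} → Prop}
    (h : VDef fun v : Fin (n + 1) → ZFSet.{u} => P (fun i => v i.castSucc) (v (Fin.last n))) :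
    VDef fun v => ∀ x, P v x := by
  obtain ⟨φ, hφ⟩ := h
  exact ⟨∀' φ, fun v => by simp [hφ]⟩

theorem ex {P : (Fin n → ZFSet.{u}) → ZFSet.{u} → Prop}
    (h : VDef fun v : Fin (n + 1) → ZFSet.{u} => P (fun i => v i.castSucc) (v (Fin.last n))) :
    VDef fun v => ∃ x, P v x := by
  obtain ⟨φ, hφ⟩ := h
  exact ⟨∃' φ, fun v => by simp [hφ]⟩

theorem forall_fin {k : ℕ} {P : Fin k → (Fin n → ZFSet.{u}) → Prop} (h : ∀ i, VDef (P i)) :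
    VDef fun v => ∀ i, P i v := by
  induction k with
  | zero => exact (not false).congr (by simp)
  | succ k ih => exact ((h 0).and (ih fun i => h i.succ)).congr fun v =>
    (Fin.forall_fin_succ (P := fun i => P i v)).symm

theorem eq_empty (i : Fin n) : VDef fun v : Fin n → ZFSet.{u} => v i = ∅ :=
  congr (P := fun v => ∀ x, ¬ x ∈ v i) (all (not (mem _ _)))
    fun v => (ZFSet.eq_empty (v i)).symm

theorem empty_mem (i : Fin n) : VDef fun v : Fin n → ZFSet.{u} => ∅ ∈ v i :=
  congr (P := fun v => ∃ x, x = ∅ ∧ x ∈ v i) (ex ((eq_empty _).and (mem _ _)))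
    fun _ => exists_eq_left

theorem eq_succ (i j : Fin n) : VDef fun v : Fin n → ZFSet.{u} => v i = insert (v j) (v j) :=
  congr (P := fun v => ∀ x, x ∈ v i ↔ x = v j ∨ x ∈ v j)
    (all ((mem _ _).iff ((eq _ _).or (mem _ _)))) fun v => by
      rw [ZFSet.ext_iff]
      simp only [ZFSet.mem_insert_iff]

theorem eq_upair (i j k : Fin n) : VDef fun v : Fin n → ZFSet.{u} => v i = {v j, v k} :=
  congr (P := fun v => ∀ x, x ∈ v i ↔ x = v j ∨ x = v k)
    (all ((mem _ _).iff ((eq _ _).or (eq _ _)))) fun v => by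
      rw [ZFSet.ext_iff]
      simp only [ZFSet.mem_pair]

theorem eq_pair (i j k : Fin n) : VDef fun v : Fin n → ZFSet.{u} => v i = ZFSet.pair (v j) (v k) :=
  congr (P := fun v => ∃ x, ∃ y, x = {v j, v j} ∧ y = {v j, v k} ∧ v i = {x, y})
    (ex (ex ((eq_upair (Fin.last n).castSucc j.castSucc.castSucc j.castSucc.castSucc).and
      ((eq_upair _ j.castSucc.castSucc k.castSucc.castSucc).and
        (eq_upair i.castSucc.castSucc (Fin.last n).castSucc _))))) fun v => by
      simp [ZFSet.pair]

theorem pair_mem (i j k : Fin n) : VDef fun v : Fin n → ZFSet.{u} => ZFSet.pair (v i) (v j) ∈ v k :=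
  congr (P := fun v => ∃ x, x = ZFSet.pair (v i) (v j) ∧ x ∈ v k)
    (ex ((eq_pair _ i.castSucc j.castSucc).and (mem _ _))) fun _ => exists_eq_left

end VDef

/-! ### Natural numbers as sets -/

/-- The von Neumann natural numbers. -/
noncomputable def natSet : ℕ → ZFSet.{u}
  | 0 => ∅
  | n + 1 => insert (natSet n) (natSet n)

theorem mem_natSet {n : ℕ} {x : ZFSet.{u}} : x ∈ natSet n ↔ ∃ m < n, natSet m = x := by
  induction n with
  | zero => simp [natSet]
  | succ n ih =>
    rw [natSet, ZFSet.mem_insert_iff, ih]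
    constructor
    · rintro (rfl | ⟨m, hm, rfl⟩)
      · exact ⟨n, n.lt_succ_self, rfl⟩
      · exact ⟨m, hm.trans n.lt_succ_self, rfl⟩
    · rintro ⟨m, hm, rfl⟩
      rcases Nat.lt_succ_iff_lt_or_eq.1 hm with h | rfl
      · exact Or.inr ⟨m, h, rfl⟩
      · exact Or.inl rfl

theorem natSet_injective : Function.Injective natSet.{u} := by
  have key : ∀ m n, m < n → natSet.{u} m ≠ natSet n := fun m n h h' =>
    ZFSet.mem_irrefl (natSet n) (mem_natSet.2 ⟨m, h, h'⟩)
  intro m n h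
  by_contra hmn
  rcases lt_or_gt_of_ne hmn with h' | h'
  · exact key m n h' h
  · exact key n m h' h.symm

theorem natSet_mem_natSet {m n : ℕ} : natSet.{u} m ∈ natSet.{u} n ↔ m < n := by
  rw [mem_natSet]
  exact ⟨fun ⟨k, hk, h⟩ => natSet_injective h ▸ hk, fun h => ⟨m, h, rfl⟩⟩

theorem natSet_mem_omega (n : ℕ) : natSet.{u} n ∈ ZFSet.omega := by
  induction n with
  | zero => exact ZFSet.omega_zero
  | succ n ih => exact ZFSet.omega_succ ih

theorem natSet_eq_mk (n : ℕ) : natSet.{u} n = ZFSet.mk (PSet.ofNat n) := by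
  induction n with
  | zero => rfl
  | succ n ih => rw [natSet, ih]; rfl

theorem mem_omega_iff {x : ZFSet.{u}} : x ∈ ZFSet.omega ↔ ∃ n, natSet n = x := by
  refine ⟨fun h => ?_, fun ⟨n, hn⟩ => hn ▸ natSet_mem_omega n⟩
  induction x using Quotient.inductionOn with
  | _ x =>
  obtain ⟨⟨n⟩, hn⟩ := h
  exact ⟨n, (natSet_eq_mk n).trans (Quotient.sound hn.symm)⟩

/-- This form, membership in every inductive set, is a first-order definition of ω. -/
theorem mem_omega_iff_forall {x : ZFSet.{u}} : x ∈ ZFSet.omega ↔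
    ∀ w : ZFSet.{u}, ∅ ∈ w → (∀ y, y ∈ w → ∀ z, z = insert y y → z ∈ w) → x ∈ w := by
  constructor
  · rw [mem_omega_iff]
    rintro ⟨n, rfl⟩ w h₀ h₁
    induction n with
    | zero => exact h₀
    | succ n ih => exact h₁ _ ih _ rfl
  · intro h
    exact h _ ZFSet.omega_zero fun y hy z hz => hz ▸ ZFSet.omega_succ hy

/-- The set that represents the number `n` in the coded model: it is not empty. -/
noncomputable def num (n : ℕ) : ZFSet.{u} := natSet (n + 1)

theorem num_injective : Function.Injective num.{u} := fun _ _ h =>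
  Nat.succ_injective (natSet_injective h)

theorem exists_num_iff {x : ZFSet.{u}} : (∃ n, num n = x) ↔ x ∈ ZFSet.omega ∧ ∅ ∈ x := by
  rw [mem_omega_iff]
  constructor
  · rintro ⟨n, rfl⟩
    exact ⟨⟨_, rfl⟩, mem_natSet.2 ⟨0, n.succ_pos, rfl⟩⟩
  · rintro ⟨⟨n, rfl⟩, h⟩
    obtain ⟨m, hm, -⟩ := mem_natSet.1 h
    exact ⟨n - 1, by rw [num, Nat.sub_add_cancel (by omega)]⟩

namespace VDef

variable {n : ℕ}

theorem mem_omega (i : Fin n) : VDef fun v : Fin n → ZFSet.{u} => v i ∈ ZFSet.omega := by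
  refine (all (P := fun v w => ∅ ∈ w → (∀ y, y ∈ w → ∀ z, z = insert y y → z ∈ w) → v i ∈ w)
    ?_).congr fun v => mem_omega_iff_forall.symm
  refine (empty_mem _).imp (imp ?_ (mem _ _))
  refine all ((mem _ (Fin.last n).castSucc).imp (all ?_))
  exact (eq_succ _ (Fin.last (n + 1)).castSucc).imp (mem _ (Fin.last n).castSucc.castSucc)

theorem subset_omega (i : Fin n) : VDef fun v : Fin n → ZFSet.{u} => v i ⊆ ZFSet.omega :=
  (all ((mem _ i.castSucc).imp (mem_omega (Fin.last n)))).congr fun _ => Iff.rfl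

theorem eq_natSet (k : ℕ) : ∀ {n : ℕ} (i : Fin n),
    VDef fun v : Fin n → ZFSet.{u} => v i = natSet k := by
  induction k with
  | zero => exact fun i => eq_empty i
  | succ k ih =>
    exact fun {n} i => congr (P := fun v => ∃ x, x = natSet k ∧ v i = insert x x)
      (ex ((ih _).and (eq_succ _ _))) fun _ => exists_eq_left

theorem exists_num (i : Fin n) : VDef fun v : Fin n → ZFSet.{u} => ∃ k, num k = v i :=
  ((mem_omega i).and (empty_mem i)).congr fun _ => exists_num_iff.symm

end VDef

/-- The graph of the binary function `f` on the codes of numbers is definable. -/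
def GraphDef (f : ℕ → ℕ → ℕ) : Prop :=
  ∀ {n : ℕ} (i j k : Fin n), VDef fun v : Fin n → ZFSet.{u} =>
    ∃ a b, v i = num a ∧ v j = num b ∧ v k = num (f a b)

/-- Recursion made first-order: the graph of f(a, ·) is the least set of pairs that contains the
initial pair and is closed under the recursion step. The dummy `b` in the base clause gives it the
binary shape of `GraphDef`. -/
theorem rec_iff {f g : ℕ → ℕ → ℕ} (hf : ∀ a b, f a (b + 1) = g (f a b) a) {x y w : ZFSet.{u}} :
    (∃ a b, x = num a ∧ y = num b ∧ w = num (f a b)) ↔ (∃ a, num a = x) ∧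
      ∀ P : ZFSet.{u}, (∀ y₀ z, (∃ a b, x = num a ∧ y₀ = num b ∧ z = num (f a 0)) → y₀ = num 0 →
        ZFSet.pair y₀ z ∈ P) →
      (∀ y z y' z', ZFSet.pair y z ∈ P → y' = insert y y →
        (∃ a b, z = num a ∧ x = num b ∧ z' = num (g a b)) → ZFSet.pair y' z' ∈ P) →
      ZFSet.pair y w ∈ P := by
  constructor
  · rintro ⟨a, b, rfl, rfl, rfl⟩
    refine ⟨⟨a, rfl⟩, fun P h₀ h₁ => ?_⟩
    induction b with
    | zero => exact h₀ _ _ ⟨a, 0, rfl, rfl, rfl⟩ rfl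
    | succ b ih => exact h₁ _ _ _ _ ih rfl ⟨_, _, rfl, rfl, by rw [hf]⟩
  · rintro ⟨⟨a, rfl⟩, h⟩
    -- Test the minimality on the graph itself.
    have := h (ZFSet.range fun b : ℕ => ZFSet.pair (num b) (num (f a b))) ?_ ?_
    · obtain ⟨b, hb⟩ := ZFSet.mem_range.1 this
      obtain ⟨rfl, rfl⟩ := ZFSet.pair_inj.1 hb
      exact ⟨a, b, rfl, rfl, rfl⟩
    · rintro _ _ ⟨a', _, ha, _, rfl⟩ rfl
      obtain rfl := num_injective ha
      exact ZFSet.mem_range.2 ⟨0, rfl⟩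
    · rintro y z y' z' hyz rfl ⟨a₁, b₁, rfl, h₁, rfl⟩
      obtain ⟨b, hb⟩ := ZFSet.mem_range.1 hyz
      obtain ⟨rfl, hz⟩ := ZFSet.pair_inj.1 hb
      obtain rfl : f a b = a₁ := num_injective hz
      obtain rfl := num_injective h₁
      exact ZFSet.mem_range.2 ⟨b + 1, by rw [hf]; rfl⟩

theorem GraphDef.of_rec {f g : ℕ → ℕ → ℕ} (hf : ∀ a b, f a (b + 1) = g (f a b) a)
    (h₀ : GraphDef.{u} fun a _ => f a 0) (hg : GraphDef.{u} g) : GraphDef.{u} f := by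
  intro n i j k
  refine VDef.congr ?_ fun v => (rec_iff hf).symm
  refine (VDef.exists_num i).and (VDef.all (VDef.imp ?_ (VDef.imp ?_ ?_)))
  · refine VDef.all (VDef.all ((h₀ i.castSucc.castSucc.castSucc _ _).imp
      ((VDef.eq_natSet 1 _).imp (VDef.pair_mem _ _ _))))
  · exact VDef.all (VDef.all (VDef.all (VDef.all ((VDef.pair_mem _ _ _).imp ((VDef.eq_succ _ _).imp
      ((hg _ i.castSucc.castSucc.castSucc.castSucc.castSucc _).imp (VDef.pair_mem _ _ _)))))))
  · exact VDef.pair_mem j.castSucc k.castSucc _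

theorem graphDef_succ : GraphDef.{u} fun a _ => a + 1 := fun i j k =>
  (((VDef.exists_num i).and (VDef.exists_num j)).and (VDef.eq_succ k i)).congr fun v => by
    constructor
    · rintro ⟨⟨⟨a, ha⟩, b, hb⟩, h⟩
      exact ⟨a, b, ha.symm, hb.symm, by rw [h, ← ha]; rfl⟩
    · rintro ⟨a, b, ha, hb, h⟩
      exact ⟨⟨⟨a, ha.symm⟩, b, hb.symm⟩, by rw [h, ha]; rfl⟩

theorem graphDef_add : GraphDef.{u} fun a b => a + b := by
  refine GraphDef.of_rec (f := fun a b => a + b) (g := fun a _ => a + 1) (fun a b => rfl) ?_ graphDef_succ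
  intro n i j k
  refine (((VDef.exists_num i).and (VDef.exists_num j)).and (VDef.eq k i)).congr fun v => ?_
  constructor
  · rintro ⟨⟨⟨a, ha⟩, b, hb⟩, h⟩
    exact ⟨a, b, ha.symm, hb.symm, by rw [h, ← ha]; rfl⟩
  · rintro ⟨a, b, ha, hb, h⟩
    exact ⟨⟨⟨a, ha.symm⟩, b, hb.symm⟩, by rw [h, ha]; rfl⟩

theorem graphDef_mul : GraphDef.{u} fun a b => a * b := by
  refine GraphDef.of_rec (f := fun a b => a * b) (g := fun a b => a + b) (fun a b => rfl) ?_ graphDef_add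
  intro n i j k
  -- Codes are shifted by one, so `natSet 1` is the code of 0 = a · 0.
  refine (((VDef.exists_num i).and (VDef.exists_num j)).and (VDef.eq_natSet 1 k)).congr fun v => ?_
  constructor
  · rintro ⟨⟨⟨a, ha⟩, b, hb⟩, h⟩
    exact ⟨a, b, ha.symm, hb.symm, h⟩
  · rintro ⟨a, b, ha, hb, h⟩
    exact ⟨⟨⟨a, ha.symm⟩, b, hb.symm⟩, h⟩

/-! ### Structures that are definable in the universe -/

/-- The domain and the relations of `A` are definable in the universe of sets. -/
structure SetStructure.IsVDef {L : FirstOrder.Language.{0, 0}} (A : SetStructure.{u} L) : Prop where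
  dom : ∀ {n : ℕ} (i : Fin n), VDef fun v => v i ∈ A.dom
  eq : ∀ {n : ℕ} (i j : Fin n), VDef fun v => A.eq (v i) (v j)
  rel : ∀ {n k : ℕ} (R : L.Relations k) (σ : Fin k → Fin n), VDef fun v => A.rel R fun i => v (σ i)

section

variable {L : FirstOrder.Language.{0, 0}} [L.IsRelational] {A : SetStructure.{u} L}

/-- Induction on one fixed formula, so no truth predicate is needed. The maps `σ` and `τ` leave the
places of the variables free, which lets the quantifier step append a new one. -/
theorem SetStructure.IsVDef.sat (hA : A.IsVDef) {α : Type} {n : ℕ} (φ : L.BoundedFormula α n) :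
    ∀ {m : ℕ} (σ : α → Fin m) (τ : Fin n → Fin m),
      VDef fun v => A.Sat φ (fun a => v (σ a)) fun i => v (τ i) := by
  have key : ∀ {m n : ℕ} (σ : α → Fin m) (τ : Fin n → Fin m) (v : Fin m → ZFSet.{u})
      (x : α ⊕ Fin n), Sum.elim (fun a => v (σ a)) (fun i => v (τ i)) x = v (Sum.elim σ τ x) := by
    rintro m n σ τ v (x | x) <;> rfl
  induction φ with
  | falsum => exact fun σ τ => VDef.false
  | equal t₁ t₂ =>
    intro m σ τ
    simp only [SetStructure.Sat, key]
    exact hA.eq _ _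
  | rel R ts =>
    intro m σ τ
    simp only [SetStructure.Sat, key]
    exact hA.rel R _
  | imp φ ψ ih₁ ih₂ => exact fun σ τ => (ih₁ σ τ).imp (ih₂ σ τ)
  | all φ ih =>
    intro m σ τ
    refine VDef.all ((hA.dom _).imp ((ih (fun a => (σ a).castSucc)
      (Fin.snoc (fun i => (τ i).castSucc) (Fin.last m))).congr fun v => iff_of_eq ?_))
    congr 1
    funext i
    refine Fin.lastCases ?_ (fun i => ?_) i <;> simp

theorem SetStructure.IsVDef.satFormula (hA : A.IsVDef) {α : Type} (φ : L.Formula α) {m : ℕ}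
    (σ : α → Fin m) : VDef fun v => A.SatFormula φ fun a => v (σ a) :=
  (hA.sat φ σ Fin.elim0).congr fun _ => iff_of_eq (congrArg _ (Subsingleton.elim _ _))

end

/-! ### The standard model of second order arithmetic, coded by sets of natural numbers -/

/-- The set that represents an object of the standard model of second order arithmetic. -/
noncomputable def code : Std → ZFSet.{u}
  | .inl n => num n
  | .inr X => ZFSet.range fun k : X => num k.1

theorem num_mem_code {k : ℕ} {X : Set ℕ} : num.{u} k ∈ code (.inr X) ↔ k ∈ X := by
  rw [code, ZFSet.mem_range]
  constructor
  · rintro ⟨⟨i, hi⟩, h⟩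
    exact num_injective h ▸ hi
  · exact fun h => ⟨⟨k, h⟩, rfl⟩

theorem empty_mem_num (n : ℕ) : ∅ ∈ num.{u} n := (exists_num_iff.1 ⟨n, rfl⟩).2

theorem empty_notMem_code (X : Set ℕ) : ∅ ∉ code.{u} (.inr X) := by
  rw [code, ZFSet.mem_range]
  rintro ⟨k, hk⟩
  exact ZFSet.notMem_empty ∅ (hk ▸ empty_mem_num.{u} k.1)

/-- The test ∅ ∈ x separates the sorts: codes of numbers contain ∅ thanks to the shift, while codes
of sets have only non-empty elements. -/
theorem code_injective : Function.Injective code.{u} := by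
  rintro (m | X) (n | Y) h
  · rw [num_injective h]
  · exact absurd (h ▸ empty_mem_num m : ∅ ∈ code (.inr Y)) (empty_notMem_code Y)
  · exact absurd (h ▸ empty_mem_num n : ∅ ∈ code (.inr X)) (empty_notMem_code X)
  · congr
    ext k
    rw [← num_mem_code, h, num_mem_code]

theorem exists_code_set_iff {x : ZFSet.{u}} :
    (∃ X, code (.inr X) = x) ↔ x ⊆ ZFSet.omega ∧ ∅ ∉ x := by
  constructor
  · rintro ⟨X, rfl⟩
    refine ⟨fun y hy => ?_, empty_notMem_code X⟩
    obtain ⟨k, rfl⟩ := ZFSet.mem_range.1 hy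
    exact natSet_mem_omega _
  · rintro ⟨h, h₀⟩
    refine ⟨{k | num k ∈ x}, ZFSet.ext fun y => ?_⟩
    rw [code, ZFSet.mem_range]
    constructor
    · rintro ⟨⟨k, hk⟩, rfl⟩
      exact hk
    · intro hy
      obtain ⟨n, rfl⟩ := mem_omega_iff.1 (h hy)
      cases n with
      | zero => exact absurd hy h₀
      | succ n => exact ⟨⟨n, hy⟩, rfl⟩

theorem code_subset_omega (a : Std) : code.{u} a ⊆ ZFSet.omega := by
  rcases a with n | X
  · intro y hy
    obtain ⟨m, -, rfl⟩ := mem_natSet.1 hy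
    exact natSet_mem_omega m
  · exact (exists_code_set_iff.1 ⟨X, rfl⟩).1

/-- The standard model of second order arithmetic, on a set of sets of natural numbers. -/
noncomputable def stdModel : SetStructure.{u} Larith where
  dom := ZFSet.range code.{u}
  eq a b := a = b ∧ a ∈ ZFSet.range code.{u}
  rel R a := ∃ x, (∀ i, code (x i) = a i) ∧ Structure.RelMap R x
  dom_of_eq := by
    rintro a b ⟨rfl, h⟩
    exact ⟨h, h⟩
  dom_of_rel := by
    rintro k R a ⟨x, hx, -⟩ i
    exact ZFSet.mem_range.2 ⟨x i, hx i⟩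

theorem mem_stdModel_dom {z : ZFSet.{u}} : z ∈ stdModel.dom ↔ ∃ a, code a = z := ZFSet.mem_range

theorem stdModel_eq_code (a b : Std) : stdModel.{u}.eq (code a) (code b) ↔ a = b :=
  ⟨fun h => code_injective h.1, fun h => ⟨congrArg _ h, mem_stdModel_dom.2 ⟨a, rfl⟩⟩⟩

theorem stdModel_rel_code {k : ℕ} (R : Larith.Relations k) (x : Fin k → Std) :
    stdModel.{u}.rel R (fun i => code (x i)) ↔ Structure.RelMap R x := by
  constructor
  · rintro ⟨y, hy, h⟩
    obtain rfl : y = x := funext fun i => code_injective (hy i)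
    exact h
  · exact fun h => ⟨x, fun _ => rfl, h⟩

theorem stdModel_normal : stdModel.{u}.Normal :=
  fun _ hx _ _ => ⟨fun h => h.1, fun h => ⟨h, hx⟩⟩

theorem stdModel_isModel : stdModel.{u}.IsModel SOA where
  nonempty := ⟨_, mem_stdModel_dom.2 ⟨.inl 0, rfl⟩⟩
  refl _ hx := ⟨rfl, hx⟩
  symm := by
    rintro x _ ⟨rfl, h⟩
    exact ⟨rfl, h⟩
  trans := by
    rintro x _ _ ⟨rfl, h⟩ ⟨rfl, -⟩
    exact ⟨rfl, h⟩
  congr R x y h hx := by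
    obtain rfl : x = y := funext fun i => (h i).1
    exact hx
  sat φ hφ := (SetStructure.satFormula_iff_models (fun _ => mem_stdModel_dom) stdModel_eq_code
    stdModel_rel_code φ).2 (std_models_SOA φ hφ)

/-- Numbers are the elements of ω that contain ∅, sets are the subsets of ω that do not; order and
membership both become ∈, and addition and multiplication come from recursion. -/
theorem stdModel_isVDef : stdModel.{u}.IsVDef := by
  have hset : ∀ {n : ℕ} (i : Fin n), VDef fun v : Fin n → ZFSet.{u} => ∃ X, code (.inr X) = v i :=
    fun i => ((VDef.subset_omega i).and (VDef.empty_mem i).not).congr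
      fun v => exists_code_set_iff.symm
  have hdom : ∀ {n : ℕ} (i : Fin n), VDef fun v : Fin n → ZFSet.{u} => v i ∈ stdModel.dom := by
    refine fun i => ((VDef.exists_num i).or (hset i)).congr fun v => ?_
    rw [mem_stdModel_dom, Sum.exists]
    rfl
  have hnat : ∀ {n : ℕ} (i : Fin n) (k : ℕ), VDef fun v : Fin n → ZFSet.{u} => num k = v i :=
    fun i k => (VDef.eq_natSet (k + 1) i).congr fun v => eq_comm
  refine ⟨hdom, fun i j => (VDef.eq i j).and (hdom i), fun {n k} R σ => ?_⟩
  cases R with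
  | num =>
    refine (VDef.exists_num (σ 0)).congr fun v => ?_
    constructor
    · rintro ⟨k, hk⟩
      exact ⟨fun _ => .inl k, fun i => by rw [Subsingleton.elim i 0]; exact hk, k, rfl⟩
    · rintro ⟨x, (hx : ∀ i, code (x i) = v (σ i)), k, hk⟩
      exact ⟨k, by rw [← hx, hk]; rfl⟩
  | zero =>
    refine (hnat (σ 0) 0).congr fun v => ?_
    constructor
    · intro hk
      exact ⟨fun _ => .inl 0, fun i => by rw [Subsingleton.elim i 0]; exact hk, rfl⟩
    · rintro ⟨x, (hx : ∀ i, code (x i) = v (σ i)), hk⟩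
      rw [← hx, show x 0 = .inl 0 from hk]; rfl
  | one =>
    refine (hnat (σ 0) 1).congr fun v => ?_
    constructor
    · intro hk
      exact ⟨fun _ => .inl 1, fun i => by rw [Subsingleton.elim i 0]; exact hk, rfl⟩
    · rintro ⟨x, (hx : ∀ i, code (x i) = v (σ i)), hk⟩
      rw [← hx, show x 0 = .inl 1 from hk]; rfl
  | add =>
    refine (graphDef_add (σ 0) (σ 1) (σ 2)).congr fun v => ?_
    constructor
    · rintro ⟨a, b, ha, hb, hc⟩
      refine ⟨![.inl a, .inl b, .inl (a + b)], fun i => ?_, a, b, rfl, rfl, rfl⟩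
      fin_cases i
      exacts [ha.symm, hb.symm, hc.symm]
    · rintro ⟨x, (hx : ∀ i, code (x i) = v (σ i)), a, b, ha, hb, hc⟩
      exact ⟨a, b, by rw [← hx, ha]; rfl, by rw [← hx, hb]; rfl, by rw [← hx, hc]; rfl⟩
  | mul =>
    refine (graphDef_mul (σ 0) (σ 1) (σ 2)).congr fun v => ?_
    constructor
    · rintro ⟨a, b, ha, hb, hc⟩
      refine ⟨![.inl a, .inl b, .inl (a * b)], fun i => ?_, a, b, rfl, rfl, rfl⟩
      fin_cases i
      exacts [ha.symm, hb.symm, hc.symm]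
    · rintro ⟨x, (hx : ∀ i, code (x i) = v (σ i)), a, b, ha, hb, hc⟩
      exact ⟨a, b, by rw [← hx, ha]; rfl, by rw [← hx, hb]; rfl, by rw [← hx, hc]; rfl⟩
  | lt =>
    refine (((VDef.exists_num (σ 0)).and (VDef.exists_num (σ 1))).and
      (VDef.mem (σ 0) (σ 1))).congr fun v => ?_
    constructor
    · rintro ⟨⟨⟨a, ha⟩, b, hb⟩, h⟩
      rw [← ha, ← hb] at h
      refine ⟨![.inl a, .inl b], fun i => ?_, a, b, rfl, rfl,
        Nat.succ_lt_succ_iff.1 (natSet_mem_natSet.1 h)⟩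
      fin_cases i
      exacts [ha, hb]
    · rintro ⟨x, (hx : ∀ i, code (x i) = v (σ i)), a, b, ha, hb, h⟩
      rw [← hx, ← hx, ha, hb]
      exact ⟨⟨⟨a, rfl⟩, b, rfl⟩, natSet_mem_natSet.2 (Nat.succ_lt_succ h)⟩
  | mem =>
    refine (((VDef.exists_num (σ 0)).and (hset (σ 1))).and
      (VDef.mem (σ 0) (σ 1))).congr fun v => ?_
    constructor
    · rintro ⟨⟨⟨a, ha⟩, X, hX⟩, h⟩
      rw [← ha, ← hX] at h
      refine ⟨![.inl a, .inr X], fun i => ?_, a, X, rfl, rfl, num_mem_code.1 h⟩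
      fin_cases i
      exacts [ha, hX]
    · rintro ⟨x, (hx : ∀ i, code (x i) = v (σ i)), a, X, ha, hX, h⟩
      rw [← hx, ← hx, ha, hX]
      exact ⟨⟨⟨a, rfl⟩, X, rfl⟩, num_mem_code.2 h⟩

/-! ### Translations that invert each other are one-dimensional -/

theorem rank_lt_rank_pair (x y : ZFSet.{u}) :
    x.rank < (ZFSet.pair x y).rank ∧ y.rank < (ZFSet.pair x y).rank := by
  have h : ({x, y} : ZFSet.{u}) ∈ ZFSet.pair x y := ZFSet.mem_pair.2 (Or.inr rfl)
  exact ⟨(ZFSet.rank_lt_of_mem (ZFSet.mem_pair.2 (Or.inl rfl))).trans (ZFSet.rank_lt_of_mem h),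
    (ZFSet.rank_lt_of_mem (ZFSet.mem_pair.2 (Or.inr rfl))).trans (ZFSet.rank_lt_of_mem h)⟩

theorem rank_le_rank_tuple : ∀ {n : ℕ} (x : Fin n → ZFSet.{u}) (i : Fin n),
    (x i).rank ≤ (tuple x).rank
  | 0, _, i => i.elim0
  | 1, x, i => by rw [Subsingleton.elim i 0]; rfl
  | n + 2, x, i => by
    refine Fin.cases (rank_lt_rank_pair _ _).1.le (fun i => ?_) i
    exact (rank_le_rank_tuple (fun i => x i.succ) i).trans (rank_lt_rank_pair _ _).2.le

/-- Strictness needs length at least 2, since a 1-tuple is its entry. -/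
theorem rank_lt_rank_tuple {n : ℕ} (hn : 2 ≤ n) (x : Fin n → ZFSet.{u}) (i : Fin n) :
    (x i).rank < (tuple x).rank := by
  obtain ⟨n, rfl⟩ := Nat.exists_eq_add_of_le' hn
  refine Fin.cases (rank_lt_rank_pair _ _).1 (fun i => ?_) i
  exact (rank_le_rank_tuple (fun i => x i.succ) i).trans_lt (rank_lt_rank_pair _ _).2

theorem tuple_const {n : ℕ} (hn : n = 1) (z : ZFSet.{u}) : (tuple fun _ : Fin n => z) = z := by
  subst hn
  rfl

theorem eq_const_tuple {n : ℕ} (hn : n = 1) (x : Fin n → ZFSet.{u}) : x = fun _ => tuple x := by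
  subst hn
  funext i
  rw [Subsingleton.elim i 0]
  rfl

namespace Translation

section

variable {L' L : FirstOrder.Language.{0, 0}} [L.IsRelational] {t : Translation L' L}
  {A : SetStructure.{u} L}

theorem mem_app_dom {z : ZFSet.{u}} : z ∈ (t.app A).dom ↔ ∃ x, t.InDom A x ∧ tuple x = z := by
  refine ZFSet.mem_range.trans ⟨fun ⟨x, hx⟩ => ⟨_, x.2, hx⟩, fun ⟨x, h, hx⟩ => ?_⟩
  exact ⟨⟨fun j => ⟨x j, h.1 j⟩, h⟩, hx⟩

theorem mem_app_dom_of_dim_eq_one (h : t.dim = 1) {z : ZFSet.{u}} :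
    z ∈ (t.app A).dom ↔ t.InDom A fun _ => z := by
  rw [mem_app_dom]
  constructor
  · rintro ⟨x, hx, rfl⟩
    rwa [← eq_const_tuple h x]
  · exact fun hz => ⟨_, hz, tuple_const h z⟩

theorem app_eq_of_dim_eq_one (h : t.dim = 1) {a b : ZFSet.{u}} :
    (t.app A).eq a b ↔ a ∈ (t.app A).dom ∧ b ∈ (t.app A).dom ∧
      A.SatFormula t.eqF fun p => ![a, b] p.1 := by
  simp only [mem_app_dom_of_dim_eq_one h]
  constructor
  · rintro ⟨x, hx, rfl, rfl, hs⟩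
    have hx' : ∀ i, x i = fun _ => ![tuple (x 0), tuple (x 1)] i := by
      intro i
      fin_cases i
      exacts [eq_const_tuple h _, eq_const_tuple h _]
    refine ⟨?_, ?_, ?_⟩
    · rw [← eq_const_tuple h]; exact hx 0
    · rw [← eq_const_tuple h]; exact hx 1
    · convert hs using 2 with p
      rw [hx' p.1]
  · rintro ⟨ha, hb, hs⟩
    refine ⟨fun i _ => ![a, b] i, fun i => ?_, tuple_const h a, tuple_const h b, hs⟩
    fin_cases i
    exacts [ha, hb]

theorem app_rel_of_dim_eq_one (h : t.dim = 1) {k : ℕ} (R : L'.Relations k)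
    {a : Fin k → ZFSet.{u}} : (t.app A).rel R a ↔ (∀ i, a i ∈ (t.app A).dom) ∧
      A.SatFormula (t.relF R) fun p => a p.1 := by
  simp only [mem_app_dom_of_dim_eq_one h]
  constructor
  · rintro ⟨x, hx, ha, hs⟩
    have hx' : ∀ i, x i = fun _ => a i := fun i => by rw [← ha i]; exact eq_const_tuple h _
    refine ⟨fun i => hx' i ▸ hx i, ?_⟩
    convert hs using 2 with p
    rw [hx' p.1]
  · rintro ⟨ha, hs⟩
    exact ⟨fun i _ => a i, ha, fun i => tuple_const h _, hs⟩

theorem app_isVDef (h : t.dim = 1) (hA : A.IsVDef) : (t.app A).IsVDef := by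
  have hdom : ∀ {n : ℕ} (i : Fin n), VDef fun v => v i ∈ (t.app A).dom := fun i =>
    ((VDef.forall_fin fun _ => hA.dom i).and (hA.satFormula t.domF fun _ => i)).congr
      fun v => (mem_app_dom_of_dim_eq_one h).symm
  refine ⟨hdom, fun i j => ?_, fun R σ => ?_⟩
  · refine ((hdom i).and ((hdom j).and (hA.satFormula t.eqF fun p => ![i, j] p.1))).congr
      fun v => ?_
    rw [app_eq_of_dim_eq_one h]
    have : ∀ p : Fin 2, v (![i, j] p) = ![v i, v j] p := by
      intro p
      fin_cases p <;> rfl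
    simp only [this]
  · exact ((VDef.forall_fin fun i => hdom (σ i)).and
      (hA.satFormula (t.relF R) fun p => σ p.1)).congr fun v => (app_rel_of_dim_eq_one h R).symm

end

variable {L' L : FirstOrder.Language.{0, 0}} [L.IsRelational] [L'.IsRelational]
  {t : Translation L' L} {s : Translation L L'} {A : SetStructure.{u} L}

/-- Infinite descent on rank: each z in A is an `s`-tuple of `t`-tuples of elements of A, so if one
of the dimensions exceeds 1, some element of A has smaller rank than z. -/
theorem dim_eq_one_of_app_app (h : s.app (t.app A) = A) (hA : ∃ x, x ∈ A.dom) :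
    t.dim = 1 ∧ s.dim = 1 := by
  by_contra hd
  have key : ∀ z ∈ A.dom, ∃ y ∈ A.dom, y.rank < z.rank := by
    intro z hz
    rw [← h] at hz
    obtain ⟨x, hx, rfl⟩ := mem_app_dom.1 hz
    obtain ⟨y, hy, hyx⟩ := mem_app_dom.1 (hx.1 ⟨0, s.dim_pos⟩)
    refine ⟨y ⟨0, t.dim_pos⟩, hy.1 _, ?_⟩
    have hs := rank_le_rank_tuple x ⟨0, s.dim_pos⟩
    have ht := rank_le_rank_tuple y ⟨0, t.dim_pos⟩
    rw [← hyx] at hs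
    by_cases h1 : t.dim = 1
    · have h2 : 2 ≤ s.dim := by have := s.dim_pos; omega
      exact ht.trans_lt (hyx ▸ rank_lt_rank_tuple h2 x _)
    · have h2 : 2 ≤ t.dim := by have := t.dim_pos; omega
      exact (rank_lt_rank_tuple h2 y _).trans_le hs
  have : ∀ o : Ordinal, ∀ z ∈ A.dom, z.rank ≠ o := by
    intro o
    induction o using WellFoundedLT.induction with
    | _ o ih =>
    rintro z hz rfl
    obtain ⟨y, hy, hyz⟩ := key z hz
    exact ih _ hyz y hy rfl
  obtain ⟨x, hx⟩ := hA
  exact this _ x hx rfl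

theorem app_dom_eq_of_app_app (h : s.app (t.app A) = A) (hA : ∃ x, x ∈ A.dom) :
    (t.app A).dom = A.dom := by
  obtain ⟨ht, hs⟩ := dim_eq_one_of_app_app h hA
  refine ZFSet.ext fun z => ⟨fun hz => ?_, fun hz => ?_⟩
  · exact ((mem_app_dom_of_dim_eq_one ht).1 hz).1 ⟨0, t.dim_pos⟩
  · rw [← h, mem_app_dom_of_dim_eq_one hs] at hz
    exact hz.1 ⟨0, s.dim_pos⟩

end Translation

/-! ### Identity in the translated structure -/

theorem SetStructure.IsModel.sat_congr {L : FirstOrder.Language.{0, 0}} [L.IsRelational]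
    {A : SetStructure.{u} L} {T : L.Theory} (hA : A.IsModel T) {α : Type} {n : ℕ}
    (φ : L.BoundedFormula α n) {v v' : α → ZFSet.{u}} {xs xs' : Fin n → ZFSet.{u}}
    (hv : ∀ a, A.eq (v a) (v' a)) (hxs : ∀ i, A.eq (xs i) (xs' i)) :
    A.Sat φ v xs ↔ A.Sat φ v' xs' := by
  have key : ∀ {n : ℕ} {xs xs' : Fin n → ZFSet.{u}}, (∀ i, A.eq (xs i) (xs' i)) →
      ∀ i, A.eq (Sum.elim v xs i) (Sum.elim v' xs' i) := by
    rintro n xs xs' hxs (i | i)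
    exacts [hv i, hxs i]
  induction φ with
  | falsum => rfl
  | equal t₁ t₂ =>
    have h₁ := key hxs (termVar t₁)
    have h₂ := key hxs (termVar t₂)
    exact ⟨fun h => hA.trans _ _ _ (hA.symm _ _ h₁) (hA.trans _ _ _ h h₂),
      fun h => hA.trans _ _ _ h₁ (hA.trans _ _ _ h (hA.symm _ _ h₂))⟩
  | rel R ts =>
    exact ⟨hA.congr R _ _ fun i => key hxs _, hA.congr R _ _ fun i => hA.symm _ _ (key hxs _)⟩
  | imp φ ψ ih₁ ih₂ => exact imp_congr (ih₁ hxs) (ih₂ hxs)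
  | all φ ih =>
    refine forall₂_congr fun x hx => ih fun i => ?_
    refine Fin.lastCases ?_ (fun i => ?_) i
    · simpa using hA.refl x hx
    · simpa using hxs i

theorem Translation.app_eq_iff_of_app_app {L' L : FirstOrder.Language.{0, 0}} [L.IsRelational]
    [L'.IsRelational] {t : Translation L' L} {s : Translation L L'} {A : SetStructure.{u} L}
    (h : s.app (t.app A) = A) (hA : ∃ x, x ∈ A.dom) (hn : A.Normal) {T : L'.Theory}
    (hm : (t.app A).IsModel T) {a b : ZFSet.{u}} :
    (t.app A).eq a b ↔ a = b ∧ a ∈ A.dom := by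
  have hd := app_dom_eq_of_app_app h hA
  have hs := (dim_eq_one_of_app_app h hA).2
  constructor
  · intro hab
    obtain ⟨ha, hb⟩ := (t.app A).dom_of_eq _ _ hab
    rw [hd] at ha hb
    refine ⟨(hn a ha b hb).1 ?_, ha⟩
    have haa := (hn a ha a ha).2 rfl
    rw [← h] at haa ha hb ⊢
    rw [app_eq_of_dim_eq_one hs] at haa ⊢
    -- In s(t(A)) = A the pair (a, a) satisfies `s.eqF`. Its second entry may be replaced by `b`,
    -- which t(A) does not distinguish from `a`.
    refine ⟨ha, hb, (hm.sat_congr s.eqF (fun p => ?_) fun i => i.elim0).1 haa.2.2⟩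
    obtain ⟨i, j⟩ := p
    fin_cases i
    · exact hm.refl a ((t.app A).dom_of_eq _ _ hab).1
    · exact hab
  · rintro ⟨rfl, ha⟩
    exact hm.refl _ (hd ▸ ha)

/-! ### Translation of formulas -/

/-- Both structures share the carrier and true identity, so only the relation symbols are replaced
and quantifiers need no relativization. -/
theorem exists_realize_iff {L L' : FirstOrder.Language.{0, 0}} [L.IsRelational] {N : Type}
    [L.Structure N] [L'.Structure N]
    (h : ∀ {k : ℕ} (R : L.Relations k), ∃ ρ : L'.Formula (Fin k), ∀ x : Fin k → N,
      ρ.Realize x ↔ Structure.RelMap R x) {α : Type} {n : ℕ} (φ : L.BoundedFormula α n) :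
    ∃ ψ : L'.BoundedFormula α n, ∀ (v : α → N) (xs : Fin n → N),
      ψ.Realize v xs ↔ φ.Realize v xs := by
  induction φ with
  | falsum => exact ⟨⊥, fun v xs => Iff.rfl⟩
  | equal t₁ t₂ =>
    refine ⟨(Term.var (termVar t₁)).bdEqual (Term.var (termVar t₂)), fun v xs => ?_⟩
    simp [BoundedFormula.Realize, realize_termVar]
  | @rel m k R ts =>
    obtain ⟨ρ, hρ⟩ := h R
    refine ⟨(BoundedFormula.relabel (fun i => termVar (ts i)) ρ : L'.BoundedFormula α (m + 0)),
      fun v xs => ?_⟩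
    simp only [BoundedFormula.Realize, realize_termVar, ← hρ]
    refine (BoundedFormula.realize_relabel (n := 0)).trans ?_
    exact iff_of_eq (congrArg _ (Subsingleton.elim _ _))
  | imp φ ψ ih₁ ih₂ =>
    obtain ⟨φ', hφ⟩ := ih₁
    obtain ⟨ψ', hψ⟩ := ih₂
    exact ⟨φ' ⟹ ψ', fun v xs => by simp [hφ, hψ]⟩
  | all φ ih =>
    obtain ⟨φ', hφ⟩ := ih
    exact ⟨∀' φ', fun v xs => by simp [hφ]⟩

theorem countableRelationsDefinable_of_interprets [Lset.Structure Std]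
    (h : ∀ {k : ℕ} (R : Larith.Relations k), ∃ ρ : Lset.Formula (Fin k), ∀ x : Fin k → Std,
      ρ.Realize x ↔ Structure.RelMap R x) : CountableRelationsDefinable Std := by
  intro f g
  obtain ⟨ψ, hψ⟩ := exists_realize_iff h codedRelation
  -- The four codes become parameters; the last two variables become the arguments of the relation.
  refine ⟨4, ψ.toFormula.relabel
      (Sum.elim Empty.elim ![.inl 0, .inl 1, .inl 2, .inl 3, .inr 0, .inr 1]),
    ![.inr (numIndices f), .inr (seqCode f), .inr (numIndices g), .inr (seqCode g)],
    fun x y => ?_⟩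
  rw [Formula.realize_relabel, BoundedFormula.realize_toFormula, hψ,
    ← realize_codedRelation f g Empty.elim x y]
  refine iff_of_eq (congrArg₂ _ (Subsingleton.elim _ _) (funext fun i => ?_))
  fin_cases i <;> rfl

/-! ### Ordinal definability of the well-ordering -/

/-- Definability without any parameters is the special case of an empty list of ordinals. -/
theorem VDef.ordinalDefinable {x : ZFSet.{u}} (h : VDef fun v : Fin 1 → ZFSet.{u} => v 0 = x) :
    OrdinalDefinable x := by
  obtain ⟨φ, hφ⟩ := h
  refine Set.Definable.mono (A := ∅) (Set.empty_definable_iff.2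
    ⟨φ.toFormula.relabel (Sum.elim Empty.elim id), ?_⟩) (Set.empty_subset _)
  ext v
  change v 0 = x ↔ Formula.Realize _ v
  rw [Formula.realize_relabel, BoundedFormula.realize_toFormula]
  refine (hφ v).symm.trans (iff_of_eq (congrArg₂ _ (Subsingleton.elim _ _) rfl))

section Ordinals

variable (A : SetStructure.{u} Lset)

/-- `z` is an ordinal of the structure `A`. -/
def OrdIn (z : ZFSet.{u}) : Prop :=
  z ∈ A.dom ∧
    (∀ x y, A.rel SetAxiom.memSymbol ![x, z] → A.rel SetAxiom.memSymbol ![y, x] →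
      A.rel SetAxiom.memSymbol ![y, z]) ∧
    ∀ x y w, A.rel SetAxiom.memSymbol ![x, z] → A.rel SetAxiom.memSymbol ![y, x] →
      A.rel SetAxiom.memSymbol ![w, y] → A.rel SetAxiom.memSymbol ![w, x]

/-- The set of ordinals of `A`. -/
noncomputable def ordSet : ZFSet.{u} := A.dom.sep (OrdIn A)

/-- The ordering of the ordinals of `A`. -/
noncomputable def ordRel : ZFSet.{u} :=
  (ZFSet.prod (ordSet A) (ordSet A)).sep fun p =>
    ∃ x y, p = ZFSet.pair x y ∧ A.rel SetAxiom.memSymbol ![x, y]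

variable {A}

theorem mem_ordSet {z : ZFSet.{u}} : z ∈ ordSet A ↔ OrdIn A z := by
  rw [ordSet, ZFSet.mem_sep]
  exact ⟨fun h => h.2, fun h => ⟨h.1, h⟩⟩

theorem mem_ordRel {p : ZFSet.{u}} : p ∈ ordRel A ↔ ∃ x, ∃ y, p = ZFSet.pair x y ∧
    OrdIn A x ∧ OrdIn A y ∧ A.rel SetAxiom.memSymbol ![x, y] := by
  rw [ordRel, ZFSet.mem_sep]
  constructor
  · rintro ⟨h, x, y, rfl, hxy⟩
    rw [ZFSet.pair_mem_prod, mem_ordSet, mem_ordSet] at h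
    exact ⟨x, y, rfl, h.1, h.2, hxy⟩
  · rintro ⟨x, y, rfl, hx, hy, hxy⟩
    rw [ZFSet.pair_mem_prod, mem_ordSet, mem_ordSet]
    exact ⟨⟨hx, hy⟩, x, y, rfl, hxy⟩

theorem ordinalDefinable_ordRel (hA : A.IsVDef) : OrdinalDefinable (ordRel A) := by
  have hm : ∀ {n : ℕ} (i j : Fin n), VDef fun v => A.rel SetAxiom.memSymbol ![v i, v j] := by
    refine fun i j => (hA.rel SetAxiom.memSymbol ![i, j]).congr fun v => iff_of_eq ?_
    congr 1
    funext k
    fin_cases k <;> rfl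
  have ho : ∀ {n : ℕ} (i : Fin n), VDef fun v => OrdIn A (v i) := by
    intro n i
    refine (hA.dom i).and (VDef.and (VDef.all (VDef.all ?_))
      (VDef.all (VDef.all (VDef.all ?_))))
    · exact (hm (Fin.last n).castSucc i.castSucc.castSucc).imp
        ((hm (Fin.last (n + 1)) (Fin.last n).castSucc).imp (hm _ i.castSucc.castSucc))
    · exact (hm (Fin.last n).castSucc.castSucc i.castSucc.castSucc.castSucc).imp
        ((hm (Fin.last (n + 1)).castSucc (Fin.last n).castSucc.castSucc).imp
          ((hm (Fin.last (n + 2)) (Fin.last (n + 1)).castSucc).imp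
            (hm _ (Fin.last n).castSucc.castSucc)))
  -- By extensionality, a set is `ordRel A` as soon as it has the definable elements listed here.
  refine VDef.ordinalDefinable (VDef.congr (P := fun v => ∀ p, p ∈ v 0 ↔ ∃ x, ∃ y,
    p = ZFSet.pair x y ∧ OrdIn A x ∧ OrdIn A y ∧ A.rel SetAxiom.memSymbol ![x, y]) ?_ ?_)
  · exact VDef.all ((VDef.mem 1 0).iff (VDef.ex (VDef.ex ((VDef.eq_pair 1 2 3).and
      ((ho 2).and ((ho 3).and (hm 2 3)))))))
  · intro v
    simp only [← mem_ordRel]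
    exact ZFSet.ext_iff.symm

variable [Lset.Structure Std] (hdom : ∀ z, z ∈ A.dom ↔ ∃ a : Std, code a = z)
  (hrel : ∀ {k : ℕ} (R : Lset.Relations k) (x : Fin k → Std),
    A.rel R (fun i => code (x i)) ↔ Structure.RelMap R x)
include hrel

theorem rel_mem_code_iff (a b : Std) :
    A.rel SetAxiom.memSymbol ![code a, code b] ↔ E a b := by
  rw [E, ← hrel]
  refine iff_of_eq (congrArg _ (funext fun i => ?_))
  fin_cases i <;> rfl

include hdom

theorem ordIn_code_iff (a : Std) : OrdIn A (code a) ↔ IsOrd a := by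
  have hm := rel_mem_code_iff hrel
  have hc : ∀ x z, A.rel SetAxiom.memSymbol ![x, z] → ∃ b : Std, code b = x := fun x z h =>
    (hdom x).1 (A.dom_of_rel _ _ h 0)
  constructor
  · rintro ⟨-, h₁, h₂⟩
    simp only [IsOrd, ← hm]
    exact ⟨fun y z => h₁ _ _, fun y z w => h₂ _ _ _⟩
  · rintro ⟨h₁, h₂⟩
    simp only [← hm] at h₁ h₂
    refine ⟨(hdom _).2 ⟨a, rfl⟩, fun x y hx hy => ?_, fun x y w hx hy hw => ?_⟩
    · obtain ⟨x, rfl⟩ := hc _ _ hx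
      obtain ⟨y, rfl⟩ := hc _ _ hy
      exact h₁ x y hx hy
    · obtain ⟨x, rfl⟩ := hc _ _ hx
      obtain ⟨y, rfl⟩ := hc _ _ hy
      obtain ⟨w, rfl⟩ := hc _ _ hw
      exact h₂ x y w hx hy hw

/-- The ordinals of the structure, coded as sets, are the ordinals of the structure on codes. -/
theorem nonempty_ordRelIso : Nonempty
    ((fun x y : {a : Std // IsOrd a} => E x.1 y.1) ≃r codedRel (ordRel A) (ordSet A)) := by
  let f : {a : Std // IsOrd a} → ordSet A := fun a =>
    ⟨code a.1, mem_ordSet.2 ((ordIn_code_iff hdom hrel a.1).2 a.2)⟩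
  have hf : f.Bijective := by
    refine ⟨fun a b h => Subtype.ext (code_injective (congrArg Subtype.val h)), ?_⟩
    rintro ⟨z, hz⟩
    have hz' := mem_ordSet.1 hz
    obtain ⟨a, rfl⟩ := (hdom z).1 hz'.1
    exact ⟨⟨a, (ordIn_code_iff hdom hrel a).1 hz'⟩, rfl⟩
  refine ⟨⟨Equiv.ofBijective f hf, fun {a b} => ?_⟩⟩
  change ZFSet.pair (f a).1 (f b).1 ∈ ordRel A ↔ E a.1 b.1
  rw [mem_ordRel, ← rel_mem_code_iff hrel]
  constructor
  · rintro ⟨x, y, h, -, -, hxy⟩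
    obtain ⟨rfl, rfl⟩ := ZFSet.pair_inj.1 h
    exact hxy
  · intro h
    exact ⟨_, _, rfl, mem_ordSet.1 (f a).2, mem_ordSet.1 (f b).2, h⟩

end Ordinals

theorem not_definitionallyEquivalent (hshort : ShortODWellOrderings.{u}) :
    ¬ DefinitionallyEquivalent.{u} SOA ZFCcount := by
  rintro ⟨t, s, ht, -, hst, -⟩
  have hB := stdModel_isModel.{u}
  have hn := stdModel_normal.{u}
  have hM := ht _ hn hB
  have h := hst _ hn hB
  have hd := Translation.app_dom_eq_of_app_app h hB.nonempty
  obtain ⟨htd, hsd⟩ := Translation.dim_eq_one_of_app_app h hB.nonempty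
  have hV := Translation.app_isVDef htd stdModel_isVDef
  have heq : ∀ a b : Std, (t.app stdModel).eq (code a) (code b) ↔ a = b := fun a b => by
    rw [Translation.app_eq_iff_of_app_app h hB.nonempty hn hM]
    exact stdModel_eq_code a b
  -- Since s(M) is the standard model, `s.relF` defines the arithmetical relations inside M.
  have hrelB : ∀ {k : ℕ} (R : Larith.Relations k) (x : Fin k → Std),
      (t.app stdModel).SatFormula (s.relF R) (fun p => code (x p.1)) ↔ Structure.RelMap R x := by
    intro k R x
    rw [← stdModel_rel_code]
    conv_rhs => rw [← h]
    rw [Translation.app_rel_of_dim_eq_one hsd, h]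
    exact (and_iff_right fun i => mem_stdModel_dom.2 ⟨x i, rfl⟩).symm
  generalize t.app stdModel = M at hM hd hV heq hrelB
  have hdom : ∀ z, z ∈ M.dom ↔ ∃ a : Std, code a = z := fun z => by rw [hd, mem_stdModel_dom]
  -- Pull M back along `code`: numbers and sets of numbers now also carry a model of set theory.
  let _ : Lset.Structure Std :=
    { funMap := fun f => isEmptyElim f
      RelMap := fun R x => M.rel R fun i => code (x i) }
  have hrel : ∀ {k : ℕ} (R : Lset.Relations k) (x : Fin k → Std),
      M.rel R (fun i => code (x i)) ↔ Structure.RelMap R x := fun R x => Iff.rfl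
  have hN : ∀ φ ∈ ZFCcount, Std ⊨ φ := fun φ hφ =>
    (M.satFormula_iff_models hdom heq hrel φ).1 (hM.sat φ hφ)
  have hC : CountableRelationsDefinable Std := by
    refine countableRelationsDefinable_of_interprets fun R =>
      ⟨(s.relF R).relabel Prod.fst, fun x => ?_⟩
    rw [Formula.realize_relabel, ← hrelB, ← M.satFormula_iff_realize hdom heq hrel]
    rfl
  obtain ⟨e⟩ := nonempty_ordRelIso hdom hrel
  have := isWellOrder_ord hN hC
  have : IsWellOrder _ (codedRel (ordRel M) (ordSet M)) := e.symm.toRelEmbedding.isWellOrder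
  have hlt := hshort (ordSet M) (ordRel M) (fun z hz => ?_) (fun p hp => ?_)
    (ordinalDefinable_ordRel hV)
  · refine uncountable_ord hN hC ?_
    have : Countable (ordSet M) := by
      -- An order type below ω₁ has cardinality below ℵ₁, so the ordinals of M would be countable.
      rw [← Cardinal.ord_aleph, Cardinal.lt_ord, Ordinal.card_type] at hlt
      exact Cardinal.mk_le_aleph0_iff.1 (Cardinal.lt_aleph_one_iff.1 hlt)
    exact e.toEquiv.countable_iff.2 this
  · obtain ⟨a, rfl⟩ := (hdom z).1 (mem_ordSet.1 hz).1
    exact ZFSet.mem_powerset.2 (code_subset_omega a)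
  · exact (ZFSet.mem_sep.1 hp).1

end SOAZFC

open SOAZFC
theorem mainTheorem3 (hshort : ShortODWellOrderings.{u}) :
    ¬ DefinitionallyEquivalent.{u} SOA ZFCcount := not_definitionallyEquivalent hshort
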